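/- For $\nu>\tfrac12$ consider the Dirichlet eigenvalue problem $$-u''(x)+\frac{\nu^2-\frac14}{x^2}\,u(x)=E\,u(x)\quad (0<x<1),\qquad u(0)=0,\quad u(1)=0,$$ where a real number $E$ is an eigenvalue if there is a function $u$, continuous on $[0,1]$, twice differentiable on $(0,1)$ and not identically zero, which satisfies the equation and the boundary conditions. The eigenvalues form an infinite strictly increasing sequence $E_1(\nu)<E_2(\nu)<\cdots$, and the following holds. 1. For every $t>0$ the series $$H(t,\nu):=\Big(\nu^2-\tfrac14\Big)^{-1/2}\sum_{k\ge1}\exp\!\Big(-t\,\big(\nu^2-\tfrac14\big)^{-1}E_k(\nu)\Big)$$ converges for all $\nu>\tfrac12$, and $\nu\mapsto H(t,\nu)$ is strictly increasing on $(\tfrac12,\infty)$. 2. For every $p>\tfrac12$ and every $\nu>\tfrac12$ the series $\sum_{k\ge1}E_k(\nu)^{-p}$ converges, the function $\nu\mapsto(\nu^2-\frac14)^{p-1/2}\sum_{k\ge1}E_k(\nu)^{-p}$ is differentiable on $(\tfrac12,\infty)$, and $$\frac{d}{d\nu}\Big[\big(\nu^2-\tfrac14\big)^{p-1/2}\sum_{k\ge1}E_k(\nu)^{-p}\Big]\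 \ge\ 0;$$ in particular this function is nondecreasing in $\nu$. -/

import Mathlib

/-- `u` is an eigenfunction, with eigenvalue `E`, of the Dirichlet problem
`-u'' + ((ν² - 1/4) / x²) u = E u` on `(0, 1)`, `u(0) = 0`, `u(1) = 0`:
it is continuous on `[0, 1]`, twice differentiable on `(0, 1)` and not identically zero. -/
structure IsBesselDirichletEigenfunction (ν E : ℝ) (u : ℝ → ℝ) : Prop where
  continuousOn : ContinuousOn u (Set.Icc 0 1)
  differentiableOn : DifferentiableOn ℝ u (Set.Ioo 0 1)
  differentiableOn_deriv : DifferentiableOn ℝ (deriv u) (Set.Ioo 0 1)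
  equation : ∀ x ∈ Set.Ioo (0 : ℝ) 1,
    -deriv (deriv u) x + (ν ^ 2 - 1 / 4) / x ^ 2 * u x = E * u x
  left_boundary : u 0 = 0
  right_boundary : u 1 = 0
  nontrivial : ∃ x ∈ Set.Ioo (0 : ℝ) 1, u x ≠ 0

/-- The set of eigenvalues of the Dirichlet problem with parameter `ν`. -/
def besselDirichletEigenvalues (ν : ℝ) : Set ℝ :=
  {E | ∃ u : ℝ → ℝ, IsBesselDirichletEigenfunction ν E u}

/-- The eigenvalues listed in increasing order, counted from `0`: `besselE ν k` is
`E_{k+1}(ν)`, the smallest eigenvalue larger than the previous ones. -/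
noncomputable def besselE (ν : ℝ) : ℕ → ℝ
  | 0 => sInf (besselDirichletEigenvalues ν)
  | k + 1 => sInf (besselDirichletEigenvalues ν ∩ Set.Ioi (besselE ν k))

/-- `H(t, ν) = (ν² - 1/4)^{-1/2} ∑ₖ exp(-t (ν² - 1/4)^{-1} Eₖ(ν))`. -/
noncomputable def besselPartition (t ν : ℝ) : ℝ :=
  (ν ^ 2 - 1 / 4) ^ (-(1 / 2) : ℝ) *
    ∑' k : ℕ, Real.exp (-t * (ν ^ 2 - 1 / 4)⁻¹ * besselE ν k)

/-- `(ν² - 1/4)^{p - 1/2} ∑ₖ Eₖ(ν)^{-p}`. -/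
noncomputable def besselMoment (p ν : ℝ) : ℝ :=
  (ν ^ 2 - 1 / 4) ^ (p - 1 / 2) * ∑' k : ℕ, besselE ν k ^ (-p)

open Set Filter Topology MeasureTheory
open scoped unitInterval

/-! Put c = ν² - 1/4, so that the operator is p² + c/x² with p² = -d²/dx², and let T_k be the mean
of p² in the k-th normalized eigenfunction. By Feynman–Hellmann (`hasDerivAt_besselE`) the
derivative of E_k in c is the mean of 1/x², so E_k/c has c-derivative -T_k/c². With s = t/c, the
ν-derivative of `besselPartition` is then a positive multiple of 2s ∑ exp(-s E_k) T_k - ∑ exp(-s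
E_k), and monotonicity becomes the strict trace inequality `tsum_exp_besselE_lt`.

That inequality follows from two sum rules. If a_jk are the squared matrix elements of x, the
commutation of position and momentum gives ∑_k (E_k - E_j) a_jk = 1 and ∑_k (E_k - E_j)² a_jk = 4
T_j (`exists_position_matrix`). Weighting by exp(-s E_j), summing over j and symmetrizing in j and k
reduces the claim to tanh y < y, term by term (`tsum_exp_lt_of_sum_rules`).

The sum rules are Parseval identities and need completeness of the eigenfunctions
(`orthogonal_span_besselSol`), which comes from the spectral theorem for the compact Green operator.
The eigenvalues are the squares of the positive zeros of the regular solution x^(ν+1/2) ·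
`besselSeries` at energy 1. Sturm comparison spaces these zeros by at least π, which gives all
convergence; their simplicity gives continuity in ν, and an exact Wronskian identity upgrades this
to differentiability.

The moments are Mellin transforms of the partition function in t
(`integral_rpow_mul_besselPartition`), so they inherit its monotonicity. -/

/-! ### Comparison principle and uniqueness for u'' = Q u. -/

theorem nonneg_of_isLocalMin_of_hasDerivAt {w w' : ℝ → ℝ} {x₀ w'' : ℝ} (hmin : IsLocalMin w x₀)
    (hw : ∀ᶠ x in 𝓝 x₀, HasDerivAt w (w' x) x) (hw' : HasDerivAt w' w'' x₀) : 0 ≤ w'' := by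
  by_contra! hneg
  have hd : deriv w =ᶠ[𝓝 x₀] w' := hw.mono fun x hx => hx.deriv
  have hdd : deriv (deriv w) x₀ = w'' := by rw [hd.deriv_eq, hw'.deriv]
  -- A negative second derivative would make `x₀` a local maximum too, so `w` would be constant near
  -- `x₀`.
  have hmax : IsLocalMax w x₀ :=
    isLocalMax_of_deriv_deriv_neg (by rw [hdd]; exact hneg) hmin.deriv_eq_zero
      hw.self_of_nhds.continuousAt
  have hconst : w =ᶠ[𝓝 x₀] fun _ => w x₀ := by
    filter_upwards [hmin, hmax] with x h1 h2 using le_antisymm h2 h1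
  have h0 : deriv w =ᶠ[𝓝 x₀] fun _ => 0 := by
    have := hconst.deriv
    simpa using this
  rw [h0.deriv_eq] at hdd
  simp at hdd
  linarith

/-- One half of the comparison principle: a solution which vanishes at both ends is nonpositive
in the presence of a positive strict supersolution. -/
theorem nonpos_of_strict_supersolution {a b : ℝ} {u u' s s' s'' Q : ℝ → ℝ}
    (hu : ContinuousOn u (Icc a b)) (hs : ContinuousOn s (Icc a b))
    (hpos : ∀ x ∈ Icc a b, 0 < s x) (hua : u a = 0) (hub : u b = 0)
    (hu' : ∀ x ∈ Ioo a b, HasDerivAt u (u' x) x)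
    (hu'' : ∀ x ∈ Ioo a b, HasDerivAt u' (Q x * u x) x)
    (hs' : ∀ x ∈ Ioo a b, HasDerivAt s (s' x) x)
    (hs'' : ∀ x ∈ Ioo a b, HasDerivAt s' (s'' x) x)
    (hlt : ∀ x ∈ Ioo a b, s'' x < Q x * s x) : ∀ x ∈ Icc a b, u x ≤ 0 := by
  intro y hy
  by_contra! hyp
  have hq : ContinuousOn (fun x => u x / s x) (Icc a b) :=
    hu.div hs fun x hx => (hpos x hx).ne'
  obtain ⟨x₀, hx₀, hmax⟩ := isCompact_Icc.exists_isMaxOn ⟨y, hy⟩ hq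
  set M := u x₀ / s x₀ with hM
  have hMpos : 0 < M := lt_of_lt_of_le (div_pos hyp (hpos y hy)) (hmax hy)
  have hu0 : u x₀ = M * s x₀ := by rw [hM, div_mul_cancel₀ _ (hpos _ hx₀).ne']
  have hux : 0 < u x₀ := by rw [hu0]; exact mul_pos hMpos (hpos _ hx₀)
  have hx₀' : x₀ ∈ Ioo a b := by
    refine ⟨lt_of_le_of_ne hx₀.1 ?_, lt_of_le_of_ne hx₀.2 ?_⟩
    · rintro rfl; linarith
    · rintro rfl; linarith
  have hnhds : Ioo a b ∈ 𝓝 x₀ := Ioo_mem_nhds hx₀'.1 hx₀'.2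
  -- At a positive maximum `M` of `u / s`, `M s - u` is nonnegative and touches zero, so its second
  -- derivative is nonnegative there; but it equals `M (s'' - Q s) < 0`.
  have hmin : IsLocalMin (fun x => M * s x - u x) x₀ := by
    filter_upwards [hnhds] with x hx
    have h1 : u x / s x ≤ M := hmax (Ioo_subset_Icc_self hx)
    rw [div_le_iff₀ (hpos x (Ioo_subset_Icc_self hx))] at h1
    linarith
  have h2 := nonneg_of_isLocalMin_of_hasDerivAt hmin
    (w' := fun x => M * s' x - u' x) (w'' := M * s'' x₀ - Q x₀ * u x₀)
    (by filter_upwards [hnhds] with x hx using ((hs' x hx).const_mul M).sub (hu' x hx))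
    (((hs'' x₀ hx₀').const_mul M).sub (hu'' x₀ hx₀'))
  have h3 := mul_lt_mul_of_pos_left (hlt x₀ hx₀') hMpos
  rw [hu0] at h2
  linarith

/-- Comparison principle: in the presence of a positive strict supersolution `s`, the only solution
of `u'' = Q u` vanishing at both ends of the interval is zero. -/
theorem eq_zero_of_strict_supersolution {a b : ℝ} {u u' s s' s'' Q : ℝ → ℝ}
    (hu : ContinuousOn u (Icc a b)) (hs : ContinuousOn s (Icc a b))
    (hpos : ∀ x ∈ Icc a b, 0 < s x) (hua : u a = 0) (hub : u b = 0)
    (hu' : ∀ x ∈ Ioo a b, HasDerivAt u (u' x) x)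
    (hu'' : ∀ x ∈ Ioo a b, HasDerivAt u' (Q x * u x) x)
    (hs' : ∀ x ∈ Ioo a b, HasDerivAt s (s' x) x)
    (hs'' : ∀ x ∈ Ioo a b, HasDerivAt s' (s'' x) x)
    (hlt : ∀ x ∈ Ioo a b, s'' x < Q x * s x) : ∀ x ∈ Icc a b, u x = 0 := by
  intro x hx
  refine le_antisymm
    (nonpos_of_strict_supersolution hu hs hpos hua hub hu' hu'' hs' hs'' hlt x hx) ?_
  have := nonpos_of_strict_supersolution (u := fun x => -u x) (u' := fun x => -u' x) (Q := Q)
    hu.neg hs hpos (by simp [hua]) (by simp [hub]) (fun x hx => (hu' x hx).neg)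
    (fun x hx => by have h := (hu'' x hx).neg; rw [← mul_neg] at h; exact h) hs' hs'' hlt x hx
  linarith

/-- A solution of `u'' = Q u` which vanishes to second order at an interior point vanishes. -/
theorem eq_zero_of_second_order_linear {a b t₀ : ℝ} {u u' Q : ℝ → ℝ}
    (hQ : ContinuousOn Q (Ioo a b)) (ht₀ : t₀ ∈ Ioo a b)
    (hu' : ∀ x ∈ Ioo a b, HasDerivAt u (u' x) x)
    (hu'' : ∀ x ∈ Ioo a b, HasDerivAt u' (Q x * u x) x)
    (h0 : u t₀ = 0) (h0' : u' t₀ = 0) : ∀ x ∈ Ioo a b, u x = 0 := by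
  intro x hx
  -- `Q` may blow up at `a` and `b`; on a compact `[p, q]` around `t₀` and `x` it is bounded and the
  -- first-order system is Lipschitz.
  obtain ⟨p, hp1, hp2⟩ := exists_between (lt_min ht₀.1 hx.1)
  obtain ⟨q, hq1, hq2⟩ := exists_between (max_lt ht₀.2 hx.2)
  have hsub : Icc p q ⊆ Ioo a b := fun y hy => ⟨hp1.trans_le hy.1, hy.2.trans_lt hq2⟩
  obtain ⟨K, hK⟩ := isCompact_Icc.exists_bound_of_continuousOn (hQ.mono hsub)
  have hlip : ∀ t ∈ Ioo p q, LipschitzOnWith (max 1 K.toNNReal)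
      (fun y : ℝ × ℝ => (y.2, Q t * y.1)) univ := by
    intro t ht
    rw [lipschitzOnWith_univ]
    refine LipschitzWith.prodMk LipschitzWith.prod_snd ?_
    refine LipschitzWith.of_dist_le_mul fun y z => ?_
    rw [Real.dist_eq, ← mul_sub, abs_mul]
    refine mul_le_mul ((hK t (Ioo_subset_Icc_self ht)).trans (Real.le_coe_toNNReal K)) ?_
      (abs_nonneg _) (by positivity)
    rw [← Real.dist_eq]
    exact le_max_left _ _
  have key := ODE_solution_unique_of_mem_Ioo (v := fun t (y : ℝ × ℝ) => (y.2, Q t * y.1))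
    (s := fun _ => univ) (f := fun t => (u t, u' t)) (g := fun _ => (0, 0)) hlip
    (t₀ := t₀) ⟨(lt_min_iff.1 hp2).1, (max_lt_iff.1 hq1).1⟩
    (fun t ht => ⟨(hu' t (hsub (Ioo_subset_Icc_self ht))).prodMk
      (hu'' t (hsub (Ioo_subset_Icc_self ht))), mem_univ _⟩)
    (fun t ht => ⟨by
      have h := hasDerivAt_const t ((0 : ℝ), (0 : ℝ))
      simp only [mul_zero]
      exact h, mem_univ _⟩)
    (by simp [h0, h0'])
  have := key ⟨(lt_min_iff.1 hp2).2, (max_lt_iff.1 hq1).2⟩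
  exact congrArg Prod.fst this

/-! ### The normalized Bessel series. -/

/-- The coefficients of the normalized Bessel series `∑ (-z/4)^m / (m! (ν+1)_m)`. -/
noncomputable def besselCoeff (ν : ℝ) : ℕ → ℝ
  | 0 => 1
  | m + 1 => besselCoeff ν m * (-(4 * ((m : ℝ) + 1) * (ν + 1 + m)))⁻¹

/-- The normalized Bessel series `∑ (-z/4)^m / (m! (ν+1)_m)`. -/
noncomputable def besselSeries (ν z : ℝ) : ℝ := ∑' m : ℕ, besselCoeff ν m * z ^ m

/-- Each new denominator 4(m+1)(ν+1+m) is at least m+1. The resulting exponential majorant is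
uniform in ν ≥ 0, which later gives joint continuity in (ν, z). -/
theorem abs_besselCoeff_le {ν : ℝ} (hν : 0 ≤ ν) (m : ℕ) :
    |besselCoeff ν m| ≤ ((m.factorial : ℝ))⁻¹ := by
  induction m with
  | zero => simp [besselCoeff]
  | succ m ih =>
    rw [besselCoeff, abs_mul, Nat.factorial_succ, Nat.cast_mul, mul_inv, mul_comm (_⁻¹ : ℝ)]
    refine mul_le_mul ih ?_ (abs_nonneg _) (by positivity)
    have hm : (0 : ℝ) ≤ m := m.cast_nonneg
    rw [abs_inv, abs_neg, abs_of_nonneg (by positivity)]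
    push_cast
    refine inv_anti₀ (by positivity) ?_
    nlinarith [mul_nonneg hm hm, mul_nonneg hm hν]

theorem abs_besselCoeff_mul_pow_le {ν z R : ℝ} (hν : 0 ≤ ν) (hz : |z| ≤ R) (m : ℕ) :
    ‖besselCoeff ν m * z ^ m‖ ≤ R ^ m / m.factorial := by
  rw [Real.norm_eq_abs, abs_mul, abs_pow, div_eq_inv_mul]
  exact mul_le_mul (abs_besselCoeff_le hν m) (pow_le_pow_left₀ (abs_nonneg z) hz m)
    (by positivity) (by positivity)

theorem summable_besselSeries {ν : ℝ} (hν : 0 ≤ ν) (z : ℝ) :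
    Summable fun m : ℕ => besselCoeff ν m * z ^ m :=
  .of_norm_bounded (Real.summable_pow_div_factorial |z|)
    fun m => abs_besselCoeff_mul_pow_le hν le_rfl m

/-- Coefficient form of the rule that differentiation shifts ν to ν + 1. -/
theorem succ_mul_besselCoeff_succ {ν : ℝ} (hν : 0 ≤ ν) (m : ℕ) :
    ((m : ℝ) + 1) * besselCoeff ν (m + 1) = -(4 * (ν + 1))⁻¹ * besselCoeff (ν + 1) m := by
  have h0 : ν + 1 ≠ 0 := by positivity
  induction m with
  | zero => simp [besselCoeff]
  | succ m ih =>
    have h1 : (m : ℝ) + 1 ≠ 0 := by positivity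
    have h2 : (m : ℝ) + 1 + 1 ≠ 0 := by positivity
    have h3 : ν + 1 + 1 + m ≠ 0 := by positivity
    have h4 : ν + 1 + (m + 1) ≠ 0 := by positivity
    rw [besselCoeff.eq_2 (ν + 1) m, ← mul_assoc, ← ih, besselCoeff.eq_2 ν (m + 1)]
    push_cast
    have h5 : ν + 1 + 1 + m = ν + 1 + (m + 1) := by ring
    rw [h5]
    field_simp

theorem add_one_mul_besselCoeff {ν : ℝ} (hν : 0 ≤ ν) (m : ℕ) :
    (ν + 1) * besselCoeff ν m = (ν + 1 + m) * besselCoeff (ν + 1) m := by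
  induction m with
  | zero => simp [besselCoeff]
  | succ m ih =>
    have h1 : (m : ℝ) + 1 ≠ 0 := by positivity
    have h3 : ν + 1 + m ≠ 0 := by positivity
    have h4 : ν + 1 + 1 + m ≠ 0 := by positivity
    rw [besselCoeff, besselCoeff, ← mul_assoc, ih]
    push_cast
    field_simp
    ring

theorem besselSeries_zero (ν : ℝ) : besselSeries ν 0 = 1 := by
  rw [besselSeries, tsum_eq_single 0 fun m hm => by simp [hm]]
  simp [besselCoeff]

theorem hasDerivAt_besselSeries {ν : ℝ} (hν : 0 ≤ ν) (z : ℝ) :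
    HasDerivAt (besselSeries ν) (-(4 * (ν + 1))⁻¹ * besselSeries (ν + 1) z) z := by
  set R : ℝ := |z| + 1
  have hR : 0 < R := by positivity
  have hbound : ∀ (m : ℕ) (y : ℝ), y ∈ Ioo (-R) R →
      ‖besselCoeff ν m * (m * y ^ (m - 1))‖ ≤ m * R ^ (m - 1) / m.factorial := by
    intro m y hy
    have hy' : |y| ≤ R := (abs_lt.2 hy).le
    rw [Real.norm_eq_abs, abs_mul, div_eq_inv_mul, abs_mul, abs_pow, Nat.abs_cast]
    gcongr
    exact abs_besselCoeff_le hν m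
  have hsum : Summable fun m : ℕ => m * R ^ (m - 1) / (m.factorial : ℝ) := by
    rw [← summable_nat_add_iff 1]
    refine (Real.summable_pow_div_factorial R).congr fun m => ?_
    rw [Nat.factorial_succ]
    push_cast
    have : (m : ℝ) + 1 ≠ 0 := by positivity
    have : (m.factorial : ℝ) ≠ 0 := by positivity
    field_simp
  have hz : z ∈ Ioo (-R) R := abs_lt.1 (by simp [R])
  have h := hasDerivAt_tsum_of_isPreconnected (g := fun m y => besselCoeff ν m * y ^ m)
    (g' := fun m y => besselCoeff ν m * (m * y ^ (m - 1))) hsum isOpen_Ioo isPreconnected_Ioo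
    (fun m y _ => (hasDerivAt_pow m y).const_mul _) hbound hz (summable_besselSeries hν z) hz
  refine HasDerivAt.congr_deriv h ?_
  have hs : Summable fun m : ℕ => besselCoeff ν m * (m * z ^ (m - 1)) :=
    .of_norm_bounded hsum fun m => hbound m z hz
  rw [hs.tsum_eq_zero_add, besselSeries, ← tsum_mul_left]
  simp only [Nat.cast_zero, zero_mul, mul_zero, zero_add]
  refine tsum_congr fun m => ?_
  rw [← mul_assoc (-_), ← succ_mul_besselCoeff_succ hν]
  push_cast
  ring

/-- Termwise, (ν+1)(c_m(ν) - c_m(ν+1)) = m c_m(ν+1), and the factor m is the Euler operator z d/dz.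
Together with the derivative rule this encodes Bessel's equation. -/
theorem besselSeries_recurrence {ν : ℝ} (hν : 0 ≤ ν) (z : ℝ) :
    (ν + 1) * besselSeries ν z = (ν + 1) * besselSeries (ν + 1) z +
      z * (-(4 * (ν + 1 + 1))⁻¹ * besselSeries (ν + 1 + 1) z) := by
  have hν1 : 0 ≤ ν + 1 := by positivity
  have h1 : (ν + 1) * besselSeries ν z - (ν + 1) * besselSeries (ν + 1) z =
      ∑' m : ℕ, m * (besselCoeff (ν + 1) m * z ^ m) := by
    rw [besselSeries, besselSeries, ← tsum_mul_left, ← tsum_mul_left,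
      ← ((summable_besselSeries hν z).mul_left _).tsum_sub
        ((summable_besselSeries hν1 z).mul_left _)]
    refine tsum_congr fun m => ?_
    rw [← mul_assoc, add_one_mul_besselCoeff hν]
    ring
  have hs : Summable fun m : ℕ => m * (besselCoeff (ν + 1) m * z ^ m) := by
    refine (((summable_besselSeries hν z).mul_left (ν + 1)).sub
      ((summable_besselSeries hν1 z).mul_left (ν + 1))).congr fun m => ?_
    rw [← mul_assoc, add_one_mul_besselCoeff hν]
    ring
  rw [hs.tsum_eq_zero_add] at h1
  have h2 : ∑' m : ℕ, ((m + 1 : ℕ) : ℝ) * (besselCoeff (ν + 1) (m + 1) * z ^ (m + 1)) =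
      z * (-(4 * (ν + 1 + 1))⁻¹ * besselSeries (ν + 1 + 1) z) := by
    rw [besselSeries, ← tsum_mul_left, ← tsum_mul_left]
    refine tsum_congr fun m => ?_
    have := succ_mul_besselCoeff_succ hν1 m
    push_cast
    rw [← mul_assoc (-_), ← this]
    ring
  rw [h2] at h1
  simp only [Nat.cast_zero, zero_mul, zero_add] at h1
  linarith

theorem continuousOn_besselCoeff (m : ℕ) :
    ContinuousOn (fun ν => besselCoeff ν m) (Ioi (0 : ℝ)) := by
  induction m with
  | zero => simpa [besselCoeff] using continuousOn_const
  | succ m ih =>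
    simp only [besselCoeff]
    refine ih.mul (ContinuousOn.inv₀ (by fun_prop) fun ν hν => ?_)
    have : (0 : ℝ) < ν := hν
    have : 0 < 4 * ((m : ℝ) + 1) * (ν + 1 + m) := by positivity
    linarith

theorem continuousAt_besselSeries {p : ℝ × ℝ} (hp : 0 < p.1) :
    ContinuousAt (fun q : ℝ × ℝ => besselSeries q.1 q.2) p := by
  have hs : Ioi (0 : ℝ) ×ˢ Ioo (-(|p.2| + 1)) (|p.2| + 1) ∈ 𝓝 p :=
    prod_mem_nhds (Ioi_mem_nhds hp) (Ioo_mem_nhds (by linarith [neg_abs_le p.2])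
      (by linarith [le_abs_self p.2]))
  refine ContinuousOn.continuousAt ?_ hs
  refine continuousOn_tsum (fun m => ?_) (Real.summable_pow_div_factorial (|p.2| + 1)) ?_
  · exact ((continuousOn_besselCoeff m).comp continuousOn_fst fun q hq => hq.1).mul
      (continuousOn_snd.pow m)
  · rintro m q ⟨hq1, hq2⟩
    exact abs_besselCoeff_mul_pow_le (le_of_lt hq1) (abs_lt.2 hq2).le m

/-! ### The regular solution and its derivatives. -/

/-- The solution of `v'' = ((ν² - 1/4)/x² - E) v` regular at the origin. -/
noncomputable def besselSol (ν E x : ℝ) : ℝ := x ^ (ν + 1 / 2) * besselSeries ν (E * x ^ 2)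

/-- The quotient of `besselSol` by `x`. -/
noncomputable def besselSolDiv (ν E x : ℝ) : ℝ := x ^ (ν - 1 / 2) * besselSeries ν (E * x ^ 2)

/-- The derivative of `besselSol`. -/
noncomputable def besselSolDeriv (ν E x : ℝ) : ℝ :=
  (ν + 1 / 2) * besselSolDiv ν E x +
    x ^ (ν + 1 / 2) * (2 * E * x) * (-(4 * (ν + 1))⁻¹ * besselSeries (ν + 1) (E * x ^ 2))

/-- Since ν - 1/2 > 0, the quotient `besselSolDiv` is continuous up to the origin, so the integrals
of u²/x² have continuous integrands. -/
theorem besselSol_eq_mul_div {ν x : ℝ} (hν : 1 / 2 < ν) (E : ℝ) (hx : 0 ≤ x) :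
    besselSol ν E x = x * besselSolDiv ν E x := by
  rcases hx.eq_or_lt with rfl | hx
  · rw [besselSol, Real.zero_rpow (by linarith)]; simp
  · rw [besselSol, besselSolDiv, ← mul_assoc]
    congr 1
    rw [show ν + 1 / 2 = 1 + (ν - 1 / 2) by ring, Real.rpow_add hx, Real.rpow_one]

theorem besselSol_zero {ν : ℝ} (hν : 1 / 2 < ν) (E : ℝ) : besselSol ν E 0 = 0 := by
  rw [besselSol_eq_mul_div hν E le_rfl, zero_mul]

theorem besselSol_one (ν E : ℝ) : besselSol ν E 1 = besselSeries ν E := by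
  simp [besselSol]

theorem continuousAt_besselSeries_comp {p : ℝ × ℝ × ℝ} (hp : 1 / 2 < p.1) :
    ContinuousAt (fun q : ℝ × ℝ × ℝ => besselSeries q.1 (q.2.1 * q.2.2 ^ 2)) p :=
  ContinuousAt.comp (g := fun q : ℝ × ℝ => besselSeries q.1 q.2)
    (f := fun q : ℝ × ℝ × ℝ => (q.1, q.2.1 * q.2.2 ^ 2))
    (continuousAt_besselSeries (by simpa using (by linarith : 0 < p.1))) (by fun_prop)

theorem continuousAt_besselSolDiv {p : ℝ × ℝ × ℝ} (hp : 1 / 2 < p.1) :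
    ContinuousAt (fun q : ℝ × ℝ × ℝ => besselSolDiv q.1 q.2.1 q.2.2) p := by
  refine ContinuousAt.mul ?_ (continuousAt_besselSeries_comp hp)
  exact ContinuousAt.rpow (by fun_prop) (by fun_prop) (Or.inr (by linarith))

theorem continuousAt_besselSol {p : ℝ × ℝ × ℝ} (hp : 1 / 2 < p.1) :
    ContinuousAt (fun q : ℝ × ℝ × ℝ => besselSol q.1 q.2.1 q.2.2) p := by
  refine ContinuousAt.mul ?_ (continuousAt_besselSeries_comp hp)
  exact ContinuousAt.rpow (by fun_prop) (by fun_prop) (Or.inr (by linarith))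

theorem continuous_besselSolDiv {ν : ℝ} (hν : 1 / 2 < ν) (E : ℝ) :
    Continuous (besselSolDiv ν E) :=
  continuous_iff_continuousAt.2 fun x =>
    ContinuousAt.comp (g := fun q : ℝ × ℝ × ℝ => besselSolDiv q.1 q.2.1 q.2.2)
      (f := fun x => (ν, E, x)) (x := x) (continuousAt_besselSolDiv hν) (by fun_prop)

theorem continuous_besselSol {ν : ℝ} (hν : 1 / 2 < ν) (E : ℝ) :
    Continuous (besselSol ν E) :=
  continuous_iff_continuousAt.2 fun x =>
    ContinuousAt.comp (g := fun q : ℝ × ℝ × ℝ => besselSol q.1 q.2.1 q.2.2)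
      (f := fun x => (ν, E, x)) (x := x) (continuousAt_besselSol hν) (by fun_prop)

theorem continuous_besselSeries {ν : ℝ} (hν : 0 ≤ ν) : Continuous (besselSeries ν) :=
  continuous_iff_continuousAt.2 fun z => (hasDerivAt_besselSeries hν z).continuousAt

theorem continuous_besselSolDeriv {ν : ℝ} (hν : 1 / 2 < ν) (E : ℝ) :
    Continuous (besselSolDeriv ν E) := by
  have h1 := continuous_besselSolDiv hν E
  have h2 := continuous_besselSeries (ν := ν + 1) (by linarith)
  have h3 : Continuous fun x : ℝ => x ^ (ν + 1 / 2) :=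
    Real.continuous_rpow_const (by linarith)
  unfold besselSolDeriv
  fun_prop

theorem hasDerivAt_besselSol {ν x : ℝ} (hν : 1 / 2 < ν) (E : ℝ) (hx : 0 < x) :
    HasDerivAt (besselSol ν E) (besselSolDeriv ν E x) x := by
  have h1 : HasDerivAt (fun x : ℝ => E * x ^ 2) (2 * E * x) x :=
    ((hasDerivAt_pow 2 x).const_mul E).congr_deriv (by simp; ring)
  have h2 := (hasDerivAt_besselSeries (ν := ν) (by linarith) (E * x ^ 2)).comp x h1
  have h3 := (Real.hasDerivAt_rpow_const (x := x) (p := ν + 1 / 2) (Or.inl hx.ne')).mul h2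
  refine h3.congr_deriv ?_
  rw [besselSolDeriv, besselSolDiv, show ν + 1 / 2 - 1 = ν - 1 / 2 by ring]
  simp only [Function.comp_apply]
  ring

theorem hasDerivAt_besselSolDeriv {ν x : ℝ} (hν : 1 / 2 < ν) (E : ℝ) (hx : 0 < x) :
    HasDerivAt (besselSolDeriv ν E) (((ν ^ 2 - 1 / 4) / x ^ 2 - E) * besselSol ν E x) x := by
  have hν0 : 0 ≤ ν := by linarith
  have h1 : HasDerivAt (fun x : ℝ => E * x ^ 2) (2 * E * x) x :=
    ((hasDerivAt_pow 2 x).const_mul E).congr_deriv (by simp; ring)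
  have h2 := (hasDerivAt_besselSeries hν0 (E * x ^ 2)).comp x h1
  have h2' := (hasDerivAt_besselSeries (ν := ν + 1) (by linarith) (E * x ^ 2)).comp x h1
  have h3 := ((Real.hasDerivAt_rpow_const (x := x) (p := ν - 1 / 2) (Or.inl hx.ne')).mul
    h2).const_mul (ν + 1 / 2)
  have h4 : HasDerivAt (fun x : ℝ => 2 * E * x) (2 * E) x := by
    simpa using (hasDerivAt_id x).const_mul (2 * E)
  have h5 := ((Real.hasDerivAt_rpow_const (x := x) (p := ν + 1 / 2) (Or.inl hx.ne')).mul h4).mul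
    (h2'.const_mul (-(4 * (ν + 1))⁻¹))
  refine (h3.add h5).congr_deriv ?_
  have hrec := besselSeries_recurrence hν0 (E * x ^ 2)
  simp only [Function.comp_apply, besselSol, Pi.mul_apply]
  have e1 : x ^ (ν - 1 / 2 - 1) = x ^ (ν + 1 / 2) / x ^ 2 := by
    rw [show ν - 1 / 2 - 1 = ν + 1 / 2 - 2 by ring, Real.rpow_sub hx]; norm_num
  have e2 : x ^ (ν - 1 / 2) = x ^ (ν + 1 / 2) / x := by
    rw [show ν - 1 / 2 = ν + 1 / 2 - 1 by ring, Real.rpow_sub hx, Real.rpow_one]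
  have e3 : x ^ (ν + 1 / 2 - 1) = x ^ (ν + 1 / 2) / x := by
    rw [Real.rpow_sub hx, Real.rpow_one]
  rw [e1, e2, e3]
  set X := x ^ (ν + 1 / 2)
  set A := besselSeries ν (E * x ^ 2)
  set B := besselSeries (ν + 1) (E * x ^ 2)
  set C := besselSeries (ν + 1 + 1) (E * x ^ 2)
  -- Eliminating the series of index ν by the recurrence turns the differential equation into a
  -- rational identity.
  have hA : A = B + E * x ^ 2 * (-(4 * (ν + 1 + 1))⁻¹ * C) / (ν + 1) := by
    field_simp at hrec ⊢
    linarith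
  rw [hA]
  have : ν + 1 ≠ 0 := by positivity
  have : ν + 1 + 1 ≠ 0 := by positivity
  field_simp
  ring

/-! ### Zeros of the regular solution: simplicity, spacing, unboundedness. -/

theorem sq_sub_quarter_pos {ν : ℝ} (hν : 1 / 2 < ν) : 0 < ν ^ 2 - 1 / 4 := by nlinarith

theorem exists_besselSol_pos {ν : ℝ} (hν : 1 / 2 < ν) (E : ℝ) :
    ∃ δ > 0, ∀ x ∈ Ioc 0 δ, 0 < besselSol ν E x := by
  have h : Continuous fun x : ℝ => besselSeries ν (E * x ^ 2) :=
    (continuous_besselSeries (by linarith)).comp (by fun_prop)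
  have h0 : ∀ᶠ x in 𝓝 (0 : ℝ), 0 < besselSeries ν (E * x ^ 2) := by
    refine h.continuousAt.eventually (lt_mem_nhds ?_)
    simp [besselSeries_zero]
  obtain ⟨ε, hε, hball⟩ := Metric.eventually_nhds_iff.1 h0
  refine ⟨ε / 2, half_pos hε, fun x hx => mul_pos (Real.rpow_pos_of_pos hx.1 _) (hball ?_)⟩
  rw [Real.dist_eq, sub_zero, abs_of_pos hx.1]
  linarith [hx.2]

theorem continuousOn_bessel_potential (ν E a b : ℝ) (ha : 0 ≤ a) :
    ContinuousOn (fun x : ℝ => (ν ^ 2 - 1 / 4) / x ^ 2 - E) (Ioo a b) := by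
  refine ContinuousOn.sub (ContinuousOn.div (by fun_prop) (by fun_prop) fun x hx => ?_)
    (by fun_prop)
  have := hx.1
  have : 0 < x := by linarith
  positivity

/-- The zeros of `besselSol` are simple. -/
theorem besselSolDeriv_ne_zero {ν E x : ℝ} (hν : 1 / 2 < ν) (hx : 0 < x)
    (h0 : besselSol ν E x = 0) : besselSolDeriv ν E x ≠ 0 := by
  intro h1
  obtain ⟨δ, hδ, hpos⟩ := exists_besselSol_pos hν E
  have hm : 0 < min δ x := lt_min hδ hx
  have := eq_zero_of_second_order_linear (a := 0) (b := x + 1) (t₀ := x)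
    (continuousOn_bessel_potential ν E 0 (x + 1) le_rfl) ⟨hx, by linarith⟩
    (fun y hy => hasDerivAt_besselSol hν E hy.1)
    (fun y hy => hasDerivAt_besselSolDeriv hν E hy.1) h0 h1 (min δ x)
    ⟨hm, by linarith [min_le_right δ x]⟩
  exact (hpos _ ⟨hm, min_le_left _ _⟩).ne' this

theorem exists_besselSol_ne_zero {ν E a b : ℝ} (hν : 1 / 2 < ν) (ha : 0 ≤ a) (hab : a < b) :
    ∃ x ∈ Ioo a b, besselSol ν E x ≠ 0 := by
  by_contra! h
  have hm : (a + b) / 2 ∈ Ioo a b := ⟨by linarith, by linarith⟩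
  have hm0 : 0 < (a + b) / 2 := by linarith
  refine besselSolDeriv_ne_zero hν hm0 (h _ hm) ?_
  have h1 : besselSol ν E =ᶠ[𝓝 ((a + b) / 2)] fun _ => 0 := by
    filter_upwards [Ioo_mem_nhds hm.1 hm.2] with x hx using h x hx
  rw [← (hasDerivAt_besselSol hν E hm0).deriv, h1.deriv_eq, deriv_const]

/-- Sturm comparison with u'' = -u: the centrifugal term is positive, so on an interval shorter than
π a shifted sine is a positive strict supersolution. The case a = 0 bounds the first positive zero.
-/
theorem pi_le_sub_of_besselSol_eq_zero {ν a b : ℝ} (hν : 1 / 2 < ν) (ha : 0 ≤ a) (hab : a < b)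
    (h0a : besselSol ν 1 a = 0) (h0b : besselSol ν 1 b = 0) : Real.pi ≤ b - a := by
  by_contra! hlt
  obtain ⟨x, hx, hne⟩ := exists_besselSol_ne_zero (E := 1) hν ha hab
  have hc := sq_sub_quarter_pos hν
  -- Half of the slack, so that the argument of the sine stays in [d, π - d].
  set d := (Real.pi - (b - a)) / 2 with hd
  have hsin : ∀ x ∈ Icc a b, 0 < Real.sin (x - a + d) := fun x hx =>
    Real.sin_pos_of_pos_of_lt_pi (by linarith [hx.1]) (by linarith [hx.2])
  have hlin : ∀ x : ℝ, HasDerivAt (fun x => x - a + d) 1 x := fun x =>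
    ((hasDerivAt_id x).sub_const a).add_const d
  refine hne (eq_zero_of_strict_supersolution (s := fun x => Real.sin (x - a + d))
    (s' := fun x => Real.cos (x - a + d)) (s'' := fun x => -Real.sin (x - a + d))
    (continuous_besselSol hν 1).continuousOn (by fun_prop) hsin h0a h0b
    (fun y hy => hasDerivAt_besselSol hν 1 (ha.trans_lt hy.1))
    (fun y hy => hasDerivAt_besselSolDeriv hν 1 (ha.trans_lt hy.1))
    (fun y _ => by simpa using (hlin y).sin) (fun y _ => by simpa using (hlin y).cos)
    (fun y hy => ?_) x (Ioo_subset_Icc_self hx))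
  have hy0 : 0 < y := ha.trans_lt hy.1
  have := hsin y (Ioo_subset_Icc_self hy)
  have : 0 < (ν ^ 2 - 1 / 4) / y ^ 2 * Real.sin (y - a + d) := by positivity
  linarith

/-- Sturm comparison in the other direction: far out the solution oscillates faster than u'' = -u/4,
so it cannot keep one sign on an interval of length 2π. -/
theorem exists_besselSol_eq_zero_gt {ν : ℝ} (hν : 1 / 2 < ν) (R : ℝ) :
    ∃ x > R, besselSol ν 1 x = 0 := by
  by_contra! hne
  have hc := sq_sub_quarter_pos hν
  -- Beyond this point y² > 2(ν² - 1/4), so the centrifugal term is below 1/2.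
  set a := max (R + 1) (2 * (ν ^ 2 - 1 / 4) + 1) with ha
  have haR : R < a := by linarith [le_max_left (R + 1) (2 * (ν ^ 2 - 1 / 4) + 1)]
  have hac : 2 * (ν ^ 2 - 1 / 4) + 1 ≤ a := le_max_right _ _
  have ha0 : 0 < a := by linarith
  have hcont := continuous_besselSol hν 1
  have hsign : ∃ r : ℝ, ∀ x ∈ Icc a (a + 2 * Real.pi), 0 < r * besselSol ν 1 x := by
    have hane := hne a haR
    refine ⟨besselSol ν 1 a, fun x hx => ?_⟩
    by_contra! hle
    have hiv : (0 : ℝ) ∈ Icc (besselSol ν 1 a * besselSol ν 1 x)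
        (besselSol ν 1 a * besselSol ν 1 a) := ⟨hle, mul_self_nonneg _⟩
    obtain ⟨y, hy, hy0⟩ := intermediate_value_Icc' hx.1
      (f := fun x => besselSol ν 1 a * besselSol ν 1 x) (by fun_prop) hiv
    rcases mul_eq_zero.1 hy0 with h | h
    · exact hane h
    · exact hne y (haR.trans_le hy.1) h
  obtain ⟨r, hr⟩ := hsign
  have hlin : ∀ x : ℝ, HasDerivAt (fun x => (x - a) / 2) (1 / 2) x := fun x =>
    ((hasDerivAt_id x).sub_const a).div_const 2
  have h := eq_zero_of_strict_supersolution (a := a) (b := a + 2 * Real.pi)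
    (u := fun x => Real.sin ((x - a) / 2))
    (u' := fun x => Real.cos ((x - a) / 2) * (1 / 2)) (Q := fun _ => -(1 / 4))
    (s := fun x => r * besselSol ν 1 x) (s' := fun x => r * besselSolDeriv ν 1 x)
    (s'' := fun x => r * (((ν ^ 2 - 1 / 4) / x ^ 2 - 1) * besselSol ν 1 x))
    (by fun_prop) (by fun_prop) hr (by simp) (by simp)
    (fun y _ => (hlin y).sin)
    (fun y _ => ((hlin y).cos.mul_const _).congr_deriv (by ring))
    (fun y hy => (hasDerivAt_besselSol hν 1 (ha0.trans hy.1)).const_mul r)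
    (fun y hy => (hasDerivAt_besselSolDeriv hν 1 (ha0.trans hy.1)).const_mul r)
    (fun y hy => ?_) (a + Real.pi) ⟨by linarith [Real.pi_pos], by linarith [Real.pi_pos]⟩
  · simp at h
  · have hy0 : 0 < y := ha0.trans hy.1
    have hy1 := hy.1
    have h1 := hr y (Ioo_subset_Icc_self hy)
    have h2 : (ν ^ 2 - 1 / 4) / y ^ 2 < 1 / 2 := by
      rw [div_lt_iff₀ (by positivity)]
      nlinarith
    nlinarith

/-- By scaling, all eigenvalues are read off as squares of zeros of the single function `besselSol ν
1`. -/
theorem besselSol_one_eq_zero_iff {ν j : ℝ} (hj : 0 < j) :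
    besselSol ν 1 j = 0 ↔ besselSeries ν (j ^ 2) = 0 := by
  rw [besselSol, one_mul, mul_eq_zero, or_iff_right (Real.rpow_pos_of_pos hj _).ne']

/-! ### Eigenvalues are the positive zeros of the Bessel series. -/

namespace IsBesselDirichletEigenfunction

variable {ν E : ℝ} {u : ℝ → ℝ}

theorem hasDerivAt (h : IsBesselDirichletEigenfunction ν E u) {x : ℝ} (hx : x ∈ Ioo (0 : ℝ) 1) :
    HasDerivAt u (deriv u x) x :=
  (h.differentiableOn.differentiableAt (isOpen_Ioo.mem_nhds hx)).hasDerivAt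

theorem hasDerivAt_deriv (h : IsBesselDirichletEigenfunction ν E u) {x : ℝ}
    (hx : x ∈ Ioo (0 : ℝ) 1) :
    HasDerivAt (deriv u) (((ν ^ 2 - 1 / 4) / x ^ 2 - E) * u x) x := by
  have h1 := (h.differentiableOn_deriv.differentiableAt (isOpen_Ioo.mem_nhds hx)).hasDerivAt
  refine h1.congr_deriv ?_
  linarith [h.equation x hx]

/-- For E ≤ 0 the constant 1 is a strict supersolution. -/
theorem eigenvalue_pos (hν : 1 / 2 < ν) (h : IsBesselDirichletEigenfunction ν E u) : 0 < E := by
  by_contra! hE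
  obtain ⟨x, hx, hne⟩ := h.nontrivial
  have hc := sq_sub_quarter_pos hν
  refine hne (eq_zero_of_strict_supersolution (s := fun _ => 1) (s' := fun _ => 0)
    (s'' := fun _ => 0) h.continuousOn (by fun_prop) (fun _ _ => one_pos) h.left_boundary
    h.right_boundary (fun y hy => h.hasDerivAt hy) (fun y hy => h.hasDerivAt_deriv hy)
    (fun y _ => hasDerivAt_const y _) (fun y _ => hasDerivAt_const y _) (fun y hy => ?_) x
    (Ioo_subset_Icc_self hx))
  have : 0 < y := hy.1
  have : 0 < (ν ^ 2 - 1 / 4) / y ^ 2 := by positivity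
  linarith

/-- Every eigenfunction is a multiple of the regular solution. -/
theorem eq_mul_besselSol (hν : 1 / 2 < ν) (h : IsBesselDirichletEigenfunction ν E u) :
    ∃ r : ℝ, r ≠ 0 ∧ ∀ x ∈ Icc (0 : ℝ) 1, u x = r * besselSol ν E x := by
  have hE := h.eigenvalue_pos hν
  have hc := sq_sub_quarter_pos hν
  obtain ⟨δ₀, hδ₀, hpos⟩ := exists_besselSol_pos hν E
  -- Near the origin the centrifugal term exceeds E, so the constant 1 is a supersolution on [0, δ].
  -- Matching `u` with the regular solution at δ then forces equality on [0, δ], without a second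
  -- solution being analysed.
  obtain ⟨δ, hδ, hδ1⟩ : ∃ δ > 0, δ ≤ δ₀ ∧ δ < 1 ∧ ∀ x ∈ Ioo 0 δ, E < (ν ^ 2 - 1 / 4) / x ^ 2 := by
    set e := (ν ^ 2 - 1 / 4) / E with he
    have he0 : 0 < e := by positivity
    refine ⟨min δ₀ (min (1 / 2) (Real.sqrt e)), by positivity, min_le_left _ _,
      lt_of_le_of_lt ((min_le_right _ _).trans (min_le_left _ _)) (by norm_num), fun x hx => ?_⟩
    have h1 : x < Real.sqrt e := hx.2.trans_le ((min_le_right _ _).trans (min_le_right _ _))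
    have h2 : x ^ 2 < e := by rwa [Real.lt_sqrt hx.1.le] at h1
    have hx0 : 0 < x := hx.1
    rw [lt_div_iff₀ (by positivity)]
    rw [he, lt_div_iff₀ hE] at h2
    linarith
  obtain ⟨hδδ, hδ1, hQ⟩ := hδ1
  set r := u δ / besselSol ν E δ with hr
  set y : ℝ → ℝ := fun x => u x - r * besselSol ν E x with hy
  set y' : ℝ → ℝ := fun x => deriv u x - r * besselSolDeriv ν E x with hy'
  have hyc : ContinuousOn y (Icc 0 1) :=
    h.continuousOn.sub ((continuous_besselSol hν E).continuousOn.const_mul r)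
  have hd1 : ∀ x ∈ Ioo (0 : ℝ) 1, HasDerivAt y (y' x) x := fun x hx =>
    (h.hasDerivAt hx).sub ((hasDerivAt_besselSol hν E hx.1).const_mul r)
  have hd2 : ∀ x ∈ Ioo (0 : ℝ) 1, HasDerivAt y' (((ν ^ 2 - 1 / 4) / x ^ 2 - E) * y x) x :=
    fun x hx => ((h.hasDerivAt_deriv hx).sub
      ((hasDerivAt_besselSolDeriv hν E hx.1).const_mul r)).congr_deriv (by simp only [hy]; ring)
  have hsub : Ioo 0 δ ⊆ Ioo 0 1 := Ioo_subset_Ioo_right hδ1.le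
  have hnear : ∀ x ∈ Icc 0 δ, y x = 0 := by
    refine eq_zero_of_strict_supersolution (s := fun _ => 1) (s' := fun _ => 0)
      (s'' := fun _ => 0) (hyc.mono (Icc_subset_Icc_right hδ1.le)) (by fun_prop)
      (fun _ _ => one_pos) ?_ ?_ (fun x hx => hd1 x (hsub hx)) (fun x hx => hd2 x (hsub hx))
      (fun y _ => hasDerivAt_const y _) (fun y _ => hasDerivAt_const y _) (fun x hx => ?_)
    · simp only [hy, h.left_boundary, besselSol_zero hν, mul_zero, sub_zero]
    · simp only [hy, hr]
      rw [div_mul_cancel₀ _ (hpos δ ⟨hδ, hδδ⟩).ne', sub_self]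
    · linarith [hQ x hx]
  have hmid : δ / 2 ∈ Ioo 0 δ := ⟨by linarith, by linarith⟩
  have hy'0 : y' (δ / 2) = 0 := by
    have h1 : y =ᶠ[𝓝 (δ / 2)] fun _ => 0 := by
      filter_upwards [Ioo_mem_nhds hmid.1 hmid.2] with x hx using hnear x (Ioo_subset_Icc_self hx)
    rw [← (hd1 _ (hsub hmid)).deriv, h1.deriv_eq, deriv_const]
  -- The difference vanishes to second order at δ/2, and uniqueness propagates this to (0, 1).
  have hint : ∀ x ∈ Ioo (0 : ℝ) 1, y x = 0 :=
    eq_zero_of_second_order_linear (continuousOn_bessel_potential ν E 0 1 le_rfl) (hsub hmid)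
      hd1 hd2 (hnear _ (Ioo_subset_Icc_self hmid)) hy'0
  have hall : EqOn y (fun _ => 0) (Icc 0 1) :=
    EqOn.of_subset_closure (s := Ioo 0 1) hint hyc continuousOn_const Ioo_subset_Icc_self
      (by rw [closure_Ioo zero_ne_one])
  have hmul : ∀ x ∈ Icc (0 : ℝ) 1, u x = r * besselSol ν E x := fun x hx => by
    have := hall hx
    simp only [hy] at this
    linarith
  refine ⟨r, ?_, hmul⟩
  rintro h0
  obtain ⟨x, hx, hne⟩ := h.nontrivial
  exact hne (by rw [hmul x (Ioo_subset_Icc_self hx), h0, zero_mul])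

theorem besselSeries_eq_zero (hν : 1 / 2 < ν) (h : IsBesselDirichletEigenfunction ν E u) :
    besselSeries ν E = 0 := by
  obtain ⟨r, hr, hu⟩ := h.eq_mul_besselSol hν
  have := hu 1 ⟨zero_le_one, le_rfl⟩
  rw [h.right_boundary, besselSol_one] at this
  exact (mul_eq_zero.1 this.symm).resolve_left hr

end IsBesselDirichletEigenfunction

theorem isBesselDirichletEigenfunction_besselSol {ν E : ℝ} (hν : 1 / 2 < ν)
    (h0 : besselSeries ν E = 0) : IsBesselDirichletEigenfunction ν E (besselSol ν E) := by
  have hd : ∀ x ∈ Ioo (0 : ℝ) 1, deriv (besselSol ν E) =ᶠ[𝓝 x] besselSolDeriv ν E := fun x hx => by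
    filter_upwards [Ioi_mem_nhds hx.1] with y hy using (hasDerivAt_besselSol hν E hy).deriv
  have hdd : ∀ x ∈ Ioo (0 : ℝ) 1, HasDerivAt (deriv (besselSol ν E))
      (((ν ^ 2 - 1 / 4) / x ^ 2 - E) * besselSol ν E x) x := fun x hx =>
    (hasDerivAt_besselSolDeriv hν E hx.1).congr_of_eventuallyEq (hd x hx)
  refine ⟨(continuous_besselSol hν E).continuousOn, fun x hx =>
    (hasDerivAt_besselSol hν E hx.1).differentiableAt.differentiableWithinAt,
    fun x hx => (hdd x hx).differentiableAt.differentiableWithinAt, fun x hx => ?_,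
    besselSol_zero hν E, by rw [besselSol_one, h0], ?_⟩
  · rw [(hdd x hx).deriv]; ring
  · exact exists_besselSol_ne_zero hν le_rfl zero_lt_one

theorem mem_besselDirichletEigenvalues_iff {ν E : ℝ} (hν : 1 / 2 < ν) :
    E ∈ besselDirichletEigenvalues ν ↔ 0 < E ∧ besselSeries ν E = 0 :=
  ⟨fun ⟨_, hu⟩ => ⟨hu.eigenvalue_pos hν, hu.besselSeries_eq_zero hν⟩,
    fun h => ⟨_, isBesselDirichletEigenfunction_besselSol hν h.2⟩⟩

theorem sq_mem_besselDirichletEigenvalues_iff {ν j : ℝ} (hν : 1 / 2 < ν) (hj : 0 < j) :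
    j ^ 2 ∈ besselDirichletEigenvalues ν ↔ besselSol ν 1 j = 0 := by
  rw [mem_besselDirichletEigenvalues_iff hν, besselSol_one_eq_zero_iff hj,
    and_iff_right (by positivity)]

/-! ### Gaps between eigenvalues and their enumeration. -/

theorem pi_le_sqrt_sub_sqrt {ν E E' : ℝ} (hν : 1 / 2 < ν) (hE : E ∈ besselDirichletEigenvalues ν)
    (hE' : E' ∈ besselDirichletEigenvalues ν) (h : E < E') : Real.pi ≤ √E' - √E := by
  have h1 := ((mem_besselDirichletEigenvalues_iff hν).1 hE).1
  have h2 := h1.trans h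
  refine pi_le_sub_of_besselSol_eq_zero hν (Real.sqrt_nonneg _) (Real.sqrt_lt_sqrt h1.le h) ?_ ?_
  · rwa [← sq_mem_besselDirichletEigenvalues_iff hν (Real.sqrt_pos.2 h1), Real.sq_sqrt h1.le]
  · rwa [← sq_mem_besselDirichletEigenvalues_iff hν (Real.sqrt_pos.2 h2), Real.sq_sqrt h2.le]

theorem pi_le_sqrt {ν E : ℝ} (hν : 1 / 2 < ν) (hE : E ∈ besselDirichletEigenvalues ν) :
    Real.pi ≤ √E := by
  have h1 := ((mem_besselDirichletEigenvalues_iff hν).1 hE).1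
  have := pi_le_sub_of_besselSol_eq_zero hν le_rfl (Real.sqrt_pos.2 h1) (besselSol_zero hν 1)
    (by rwa [← sq_mem_besselDirichletEigenvalues_iff hν (Real.sqrt_pos.2 h1), Real.sq_sqrt h1.le])
  linarith

/-- Factor E' - E as a difference of squares: √E' - √E is at least π, hence so is √E' + √E. -/
theorem pi_sq_le_sub {ν E E' : ℝ} (hν : 1 / 2 < ν) (hE : E ∈ besselDirichletEigenvalues ν)
    (hE' : E' ∈ besselDirichletEigenvalues ν) (h : E < E') : Real.pi ^ 2 ≤ E' - E := by
  have h1 := ((mem_besselDirichletEigenvalues_iff hν).1 hE).1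
  have h2 := pi_le_sqrt_sub_sqrt hν hE hE' h
  have h3 := Real.sq_sqrt h1.le
  have h4 := Real.sq_sqrt (h1.trans h).le
  have := Real.pi_pos
  have := Real.sqrt_nonneg E
  nlinarith

theorem exists_mem_besselDirichletEigenvalues_gt {ν : ℝ} (hν : 1 / 2 < ν) (R : ℝ) :
    ∃ E ∈ besselDirichletEigenvalues ν, R < E := by
  obtain ⟨x, hx, h0⟩ := exists_besselSol_eq_zero_gt hν (max R 1)
  have hx1 : 1 < x := (le_max_right R 1).trans_lt hx
  refine ⟨x ^ 2, (sq_mem_besselDirichletEigenvalues_iff hν (by linarith)).2 h0, ?_⟩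
  have : R < x := (le_max_left R 1).trans_lt hx
  nlinarith

/-- A nonempty set, bounded below, with a uniform gap between its elements has a least element. -/
theorem isLeast_sInf_of_gap {S : Set ℝ} {d : ℝ} (hd : 0 < d)
    (hgap : ∀ x ∈ S, ∀ y ∈ S, x < y → d ≤ y - x) (hne : S.Nonempty) (hb : BddBelow S) :
    IsLeast S (sInf S) := by
  obtain ⟨z, hz, hlt⟩ := exists_lt_of_csInf_lt hne (lt_add_of_pos_right (sInf S) hd)
  have hmin : ∀ y ∈ S, z ≤ y := fun y hy => by
    by_contra! h
    linarith [hgap y hy z hz h, csInf_le hb hy]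
  have : sInf S = z := IsLeast.csInf_eq ⟨hz, hmin⟩
  rw [this]
  exact ⟨hz, hmin⟩

/-- Existence of eigenvalues excludes the default value of `sInf` on the empty set, and the gap
makes the infimum attained. -/
theorem isLeast_besselE_zero {ν : ℝ} (hν : 1 / 2 < ν) :
    IsLeast (besselDirichletEigenvalues ν) (besselE ν 0) := by
  obtain ⟨E, hE, -⟩ := exists_mem_besselDirichletEigenvalues_gt hν 0
  exact isLeast_sInf_of_gap (by positivity) (fun x hx y hy h => pi_sq_le_sub hν hx hy h) ⟨E, hE⟩
    ⟨0, fun x hx => ((mem_besselDirichletEigenvalues_iff hν).1 hx).1.le⟩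

theorem isLeast_besselE_succ {ν : ℝ} (hν : 1 / 2 < ν) (k : ℕ) :
    IsLeast (besselDirichletEigenvalues ν ∩ Ioi (besselE ν k)) (besselE ν (k + 1)) := by
  obtain ⟨E, hE, hlt⟩ := exists_mem_besselDirichletEigenvalues_gt hν (besselE ν k)
  exact isLeast_sInf_of_gap (by positivity) (fun x hx y hy h => pi_sq_le_sub hν hx.1 hy.1 h)
    ⟨E, hE, hlt⟩ ⟨besselE ν k, fun x hx => le_of_lt hx.2⟩

theorem besselE_mem {ν : ℝ} (hν : 1 / 2 < ν) (k : ℕ) :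
    besselE ν k ∈ besselDirichletEigenvalues ν := by
  cases k with
  | zero => exact (isLeast_besselE_zero hν).1
  | succ k => exact (isLeast_besselE_succ hν k).1.1

theorem strictMono_besselE {ν : ℝ} (hν : 1 / 2 < ν) : StrictMono (besselE ν) :=
  strictMono_nat_of_lt_succ fun k => (isLeast_besselE_succ hν k).1.2

theorem mul_pi_le_sqrt_besselE {ν : ℝ} (hν : 1 / 2 < ν) (k : ℕ) :
    ((k : ℝ) + 1) * Real.pi ≤ √(besselE ν k) := by
  induction k with
  | zero => simpa using pi_le_sqrt hν (besselE_mem hν 0)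
  | succ k ih =>
    have := pi_le_sqrt_sub_sqrt hν (besselE_mem hν k) (besselE_mem hν (k + 1))
      (strictMono_besselE hν k.lt_succ_self)
    push_cast
    linarith

theorem besselE_pos {ν : ℝ} (hν : 1 / 2 < ν) (k : ℕ) : 0 < besselE ν k :=
  ((mem_besselDirichletEigenvalues_iff hν).1 (besselE_mem hν k)).1

theorem besselSeries_besselE {ν : ℝ} (hν : 1 / 2 < ν) (k : ℕ) :
    besselSeries ν (besselE ν k) = 0 :=
  ((mem_besselDirichletEigenvalues_iff hν).1 (besselE_mem hν k)).2

/-- The bound does not involve ν, so it majorizes all later series uniformly in the parameter. -/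
theorem sq_mul_le_besselE {ν : ℝ} (hν : 1 / 2 < ν) (k : ℕ) :
    Real.pi ^ 2 * ((k : ℝ) + 1) ^ 2 ≤ besselE ν k := by
  have h := mul_pi_le_sqrt_besselE hν k
  have := pow_le_pow_left₀ (by positivity) h 2
  rw [Real.sq_sqrt (besselE_pos hν k).le] at this
  linarith

theorem range_besselE {ν : ℝ} (hν : 1 / 2 < ν) :
    range (besselE ν) = besselDirichletEigenvalues ν := by
  refine Subset.antisymm (range_subset_iff.2 (besselE_mem hν)) fun E hE => ?_
  have hex : ∃ k : ℕ, E ≤ besselE ν k := by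
    obtain ⟨k, hk⟩ := exists_nat_ge E
    refine ⟨k, hk.trans (le_trans ?_ (sq_mul_le_besselE hν k))⟩
    have h3 := Real.pi_gt_three
    have hk0 : (0 : ℝ) ≤ k := k.cast_nonneg
    have : (9 : ℝ) * (k + 1) ^ 2 ≤ Real.pi ^ 2 * (k + 1) ^ 2 := by gcongr; nlinarith
    nlinarith
  -- At the first index with `E ≤ besselE ν k`, `E` exceeds the preceding eigenvalue, so minimality
  -- gives the reverse inequality.
  refine ⟨Nat.find hex, le_antisymm ?_ (Nat.find_spec hex)⟩
  rcases hk : Nat.find hex with _ | k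
  · exact (isLeast_besselE_zero hν).2 hE
  · refine (isLeast_besselE_succ hν k).2 ⟨hE, ?_⟩
    have := Nat.find_min hex (m := k) (by omega)
    exact not_le.1 this

theorem besselSol_sqrt_besselE {ν : ℝ} (hν : 1 / 2 < ν) (k : ℕ) :
    besselSol ν 1 √(besselE ν k) = 0 := by
  rw [besselSol_one_eq_zero_iff (Real.sqrt_pos.2 (besselE_pos hν k)),
    Real.sq_sqrt (besselE_pos hν k).le, besselSeries_besselE hν]

/-! ### Continuity of the eigenvalues in ν. -/

/-- The next zero after a continuously varying bound, at distance at least `π` from it, varies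
continuously. -/
theorem continuousAt_next_zero {a b : ℝ → ℝ} {ν₀ : ℝ} (hν₀ : 1 / 2 < ν₀)
    (ha : ContinuousAt a ν₀) (ha0 : ∀ ν, 1 / 2 < ν → 0 ≤ a ν)
    (hab : ∀ ν, 1 / 2 < ν → a ν + Real.pi ≤ b ν)
    (hzero : ∀ ν, 1 / 2 < ν → besselSol ν 1 (b ν) = 0)
    (hleast : ∀ ν, 1 / 2 < ν → ∀ x > a ν, besselSol ν 1 x = 0 → b ν ≤ x) :
    ContinuousAt b ν₀ := by
  have hπ := Real.pi_pos
  have hcont : ∀ x : ℝ, ContinuousAt (fun q : ℝ × ℝ => besselSol q.1 1 q.2) (ν₀, x) := fun x =>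
    ContinuousAt.comp (g := fun q : ℝ × ℝ × ℝ => besselSol q.1 q.2.1 q.2.2)
      (f := fun q : ℝ × ℝ => (q.1, 1, q.2)) (continuousAt_besselSol hν₀) (by fun_prop)
  have hev : ∀ᶠ ν in 𝓝 ν₀, 1 / 2 < ν := lt_mem_nhds hν₀
  have hb0 : 0 < b ν₀ := by linarith [ha0 ν₀ hν₀, hab ν₀ hν₀]
  have hnear : ∀ᶠ ν in 𝓝 ν₀, a ν ∈ Ioo (a ν₀ - Real.pi / 2) (a ν₀ + Real.pi / 2) :=
    ha.eventually (Ioo_mem_nhds (by linarith) (by linarith))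
  rw [Metric.continuousAt_iff']
  intro ε' hε'
  -- With ε < π/2 the window around `b ν₀` stays above `a ν` for ν near ν₀.
  obtain ⟨ε, hε, hεε, hεπ⟩ : ∃ ε > 0, ε ≤ ε' ∧ ε < Real.pi / 2 :=
    ⟨min ε' (Real.pi / 4), by positivity, min_le_left _ _,
      (min_le_right _ _).trans_lt (by linarith)⟩
  -- At ν₀ there is no zero between `a` and `b`; by compactness none appears in the closed part for
  -- nearby ν.
  have hlow : ∀ᶠ ν in 𝓝 ν₀, b ν₀ - ε < b ν := by
    have hK : ∀ᶠ ν in 𝓝 ν₀, ∀ x ∈ Icc (a ν₀ + Real.pi / 2) (b ν₀ - ε), besselSol ν 1 x ≠ 0 := by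
      refine isCompact_Icc.eventually_forall_of_forall_eventually fun x hx => ?_
      refine (hcont x).eventually_ne fun h0 => ?_
      have := hleast ν₀ hν₀ x (by linarith [hx.1]) h0
      linarith [hx.2]
    filter_upwards [hK, hnear, hev] with ν h1 h2 h3
    by_contra! h4
    exact h1 (b ν) ⟨by linarith [hab ν h3, h2.1], h4⟩ (hzero ν h3)
  -- The zero is simple, so the solution changes sign across it; the sign change persists for nearby
  -- ν and yields a zero in the window.
  have hup : ∀ᶠ ν in 𝓝 ν₀, b ν < b ν₀ + ε := by
    obtain ⟨x₁, hx₁, x₂, hx₂, hneg⟩ : ∃ x₁ ∈ Ioo (b ν₀ - ε) (b ν₀), ∃ x₂ ∈ Ioo (b ν₀) (b ν₀ + ε),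
        besselSol ν₀ 1 x₁ * besselSol ν₀ 1 x₂ < 0 := by
      set d := besselSolDeriv ν₀ 1 (b ν₀) with hd
      have hd0 : d ≠ 0 := besselSolDeriv_ne_zero hν₀ hb0 (hzero ν₀ hν₀)
      have hder := hasDerivAt_besselSol hν₀ 1 hb0
      rw [hasDerivAt_iff_tendsto_slope] at hder
      have hpos : ∀ᶠ x in 𝓝[≠] (b ν₀), 0 < d * slope (besselSol ν₀ 1) (b ν₀) x :=
        (hder.const_mul d).eventually (lt_mem_nhds (mul_self_pos.2 hd0))
      simp only [slope_def_field, hzero ν₀ hν₀, sub_zero] at hpos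
      have hl := (hpos.filter_mono (nhdsLT_le_nhdsNE _)).and
        (Ioo_mem_nhdsLT (show b ν₀ - ε < b ν₀ by linarith))
      have hr := (hpos.filter_mono (nhdsGT_le_nhdsNE _)).and
        (Ioo_mem_nhdsGT (show b ν₀ < b ν₀ + ε by linarith))
      obtain ⟨x₁, h1, hx₁⟩ := hl.exists
      obtain ⟨x₂, h2, hx₂⟩ := hr.exists
      refine ⟨x₁, hx₁, x₂, hx₂, ?_⟩
      rw [← mul_div_assoc] at h1 h2
      have h1' : d * besselSol ν₀ 1 x₁ < 0 := by
        by_contra! h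
        exact absurd (div_nonpos_of_nonneg_of_nonpos h (by linarith [hx₁.2])) (not_le.2 h1)
      have h2' : 0 < d * besselSol ν₀ 1 x₂ := by
        by_contra! h
        exact absurd (div_nonpos_of_nonpos_of_nonneg h (by linarith [hx₂.1])) (not_le.2 h2)
      have h3 := mul_neg_of_neg_of_pos h1' h2'
      have h4 := mul_self_pos.2 hd0
      by_contra! h
      nlinarith
    have hc : ∀ x : ℝ, ContinuousAt (fun ν => besselSol ν 1 x) ν₀ := fun x =>
      ContinuousAt.comp (g := fun q : ℝ × ℝ => besselSol q.1 1 q.2) (f := fun ν => (ν, x))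
        (hcont x) (by fun_prop)
    filter_upwards [((hc x₁).mul (hc x₂)).eventually (gt_mem_nhds hneg), hnear, hev]
      with ν h1 h2 h3
    have hcν := (continuous_besselSol h3 1).continuousOn (s := Icc x₁ x₂)
    have hx12 : x₁ ≤ x₂ := (hx₁.2.trans hx₂.1).le
    obtain ⟨y, hy, hy0⟩ : ∃ y ∈ Icc x₁ x₂, besselSol ν 1 y = 0 := by
      rcases mul_neg_iff.1 h1 with ⟨hp, hn⟩ | ⟨hn, hp⟩
      · exact intermediate_value_Icc' hx12 hcν ⟨hn.le, hp.le⟩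
      · exact intermediate_value_Icc hx12 hcν ⟨hn.le, hp.le⟩
    have := hleast ν h3 y (by linarith [hy.1, hx₁.1, h2.2, hab ν₀ hν₀]) hy0
    linarith [hy.2, hx₂.2]
  filter_upwards [hlow, hup] with ν h1 h2
  rw [Real.dist_eq, abs_lt]
  constructor <;> linarith

theorem sq_mem_of_besselSol_eq_zero {ν x : ℝ} (hν : 1 / 2 < ν) (hx : 0 < x)
    (h0 : besselSol ν 1 x = 0) : x ^ 2 ∈ besselDirichletEigenvalues ν :=
  (sq_mem_besselDirichletEigenvalues_iff hν hx).2 h0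

theorem continuousAt_sqrt_besselE {ν₀ : ℝ} (hν₀ : 1 / 2 < ν₀) (k : ℕ) :
    ContinuousAt (fun ν => √(besselE ν k)) ν₀ := by
  induction k with
  | zero =>
    refine continuousAt_next_zero (a := fun _ => 0) hν₀ continuousAt_const (fun _ _ => le_rfl)
      (fun ν hν => ?_) (fun ν hν => besselSol_sqrt_besselE hν 0) fun ν hν x hx h0 => ?_
    · simpa using mul_pi_le_sqrt_besselE hν 0
    · exact Real.sqrt_le_iff.2
        ⟨le_of_lt hx, (isLeast_besselE_zero hν).2 (sq_mem_of_besselSol_eq_zero hν hx h0)⟩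
  | succ k ih =>
    refine continuousAt_next_zero hν₀ ih (fun _ _ => Real.sqrt_nonneg _)
      (fun ν hν => ?_) (fun ν hν => besselSol_sqrt_besselE hν (k + 1)) fun ν hν x hx h0 => ?_
    · linarith [pi_le_sqrt_sub_sqrt hν (besselE_mem hν k) (besselE_mem hν (k + 1))
        (strictMono_besselE hν k.lt_succ_self)]
    · have hx0 : 0 < x := (Real.sqrt_nonneg _).trans_lt hx
      refine Real.sqrt_le_iff.2 ⟨hx0.le, (isLeast_besselE_succ hν k).2
        ⟨sq_mem_of_besselSol_eq_zero hν hx0 h0, ?_⟩⟩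
      exact (Real.sqrt_lt' hx0).1 hx

theorem continuousAt_besselE {ν₀ : ℝ} (hν₀ : 1 / 2 < ν₀) (k : ℕ) :
    ContinuousAt (fun ν => besselE ν k) ν₀ := by
  refine ((continuousAt_sqrt_besselE hν₀ k).pow 2).congr ?_
  filter_upwards [lt_mem_nhds hν₀] with ν hν using Real.sq_sqrt (besselE_pos hν k).le

/-! ### Wronskian identity and Feynman–Hellmann formula. -/

theorem integral_zero_one_of_hasDerivAt {F f : ℝ → ℝ} (hF : Continuous F) (hf : Continuous f)
    (h : ∀ x > 0, HasDerivAt F (f x) x) : ∫ x in (0 : ℝ)..1, f x = F 1 - F 0 :=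
  intervalIntegral.integral_eq_sub_of_hasDerivAt_of_le zero_le_one hF.continuousOn
    (fun x hx => h x hx.1) (hf.intervalIntegrable 0 1)

/-- The Wronskian identity for two values of the parameters. -/
theorem sub_mul_integral_besselSol_mul {ν₁ ν₂ E₁ E₂ : ℝ} (hν₁ : 1 / 2 < ν₁) (hν₂ : 1 / 2 < ν₂)
    (h1 : besselSeries ν₁ E₁ = 0) (h2 : besselSeries ν₂ E₂ = 0) :
    (E₂ - E₁) * ∫ x in (0 : ℝ)..1, besselSol ν₁ E₁ x * besselSol ν₂ E₂ x =
      (ν₂ ^ 2 - ν₁ ^ 2) * ∫ x in (0 : ℝ)..1, besselSolDiv ν₁ E₁ x * besselSolDiv ν₂ E₂ x := by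
  have c1 := continuous_besselSol hν₁ E₁
  have c2 := continuous_besselSol hν₂ E₂
  have d1 := continuous_besselSolDeriv hν₁ E₁
  have d2 := continuous_besselSolDeriv hν₂ E₂
  have w1 := continuous_besselSolDiv hν₁ E₁
  have w2 := continuous_besselSolDiv hν₂ E₂
  have key := integral_zero_one_of_hasDerivAt
    (F := fun x => besselSolDeriv ν₁ E₁ x * besselSol ν₂ E₂ x -
      besselSol ν₁ E₁ x * besselSolDeriv ν₂ E₂ x)
    (f := fun x => (E₂ - E₁) * (besselSol ν₁ E₁ x * besselSol ν₂ E₂ x) -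
      (ν₂ ^ 2 - ν₁ ^ 2) * (besselSolDiv ν₁ E₁ x * besselSolDiv ν₂ E₂ x))
    (by fun_prop) (by fun_prop) fun x hx => by
      refine (((hasDerivAt_besselSolDeriv hν₁ E₁ hx).mul (hasDerivAt_besselSol hν₂ E₂ hx)).sub
        ((hasDerivAt_besselSol hν₁ E₁ hx).mul
          (hasDerivAt_besselSolDeriv hν₂ E₂ hx))).congr_deriv ?_
      rw [besselSol_eq_mul_div hν₁ E₁ (le_of_lt hx), besselSol_eq_mul_div hν₂ E₂ (le_of_lt hx)]
      have : x ≠ 0 := ne_of_gt hx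
      field_simp
      ring
  rw [intervalIntegral.integral_sub ((by fun_prop : Continuous _).intervalIntegrable 0 1)
    ((by fun_prop : Continuous _).intervalIntegrable 0 1), intervalIntegral.integral_const_mul,
    intervalIntegral.integral_const_mul] at key
  simp only [besselSol_zero hν₁, besselSol_zero hν₂, besselSol_one, h1, h2] at key
  linarith

theorem integral_besselSol_sq_pos {ν : ℝ} (hν : 1 / 2 < ν) (E : ℝ) :
    0 < ∫ x in (0 : ℝ)..1, besselSol ν E x * besselSol ν E x := by
  have c := continuous_besselSol hν E
  obtain ⟨x, hx, hne⟩ := exists_besselSol_ne_zero (E := E) hν le_rfl zero_lt_one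
  refine intervalIntegral.integral_pos zero_lt_one (by fun_prop) (fun _ _ => mul_self_nonneg _)
    ⟨x, Ioo_subset_Icc_self hx, mul_self_pos.2 hne⟩

/-- The mean value of `1/x²` in the `k`-th eigenfunction. -/
noncomputable def besselInvSq (ν : ℝ) (k : ℕ) : ℝ :=
  (∫ x in (0 : ℝ)..1, besselSolDiv ν (besselE ν k) x * besselSolDiv ν (besselE ν k) x) /
    ∫ x in (0 : ℝ)..1, besselSol ν (besselE ν k) x * besselSol ν (besselE ν k) x

theorem continuousAt_integral_mul {f : ℝ × ℝ × ℝ → ℝ}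
    (hf : ∀ p : ℝ × ℝ × ℝ, 1 / 2 < p.1 → ContinuousAt f p) {g : ℝ → ℝ} (hg : Continuous g)
    {ν₀ : ℝ} (hν₀ : 1 / 2 < ν₀) (k : ℕ) :
    ContinuousAt (fun ν => ∫ x in (0 : ℝ)..1, g x * f (ν, besselE ν k, x)) ν₀ := by
  have hc : Continuous fun ν : Ioi (1 / 2 : ℝ) =>
      ∫ x in (0 : ℝ)..1, g x * f (ν.1, besselE ν.1 k, x) := by
    refine intervalIntegral.continuous_parametric_intervalIntegral_of_continuous'
      (f := fun (ν : Ioi (1 / 2 : ℝ)) x => g x * f (ν.1, besselE ν.1 k, x)) ?_ 0 1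
    refine (hg.comp continuous_snd).mul (continuous_iff_continuousAt.2 fun q => ?_)
    -- Working on the subtype ν > 1/2 makes the integrand globally continuous.
    refine ContinuousAt.comp (g := f)
      (f := fun q : Ioi (1 / 2 : ℝ) × ℝ => (q.1.1, besselE q.1.1 k, q.2)) (hf _ q.1.2) ?_
    refine ContinuousAt.prodMk (by fun_prop) (ContinuousAt.prodMk ?_ (by fun_prop))
    exact ContinuousAt.comp (g := fun ν => besselE ν k)
      (f := fun q : Ioi (1 / 2 : ℝ) × ℝ => q.1.1) (continuousAt_besselE q.1.2 k) (by fun_prop)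
  exact (continuousOn_iff_continuous_domRestrict.2 hc).continuousAt (Ioi_mem_nhds hν₀)

/-- The Feynman–Hellmann formula. -/
theorem hasDerivAt_besselE {ν₀ : ℝ} (hν₀ : 1 / 2 < ν₀) (k : ℕ) :
    HasDerivAt (fun ν => besselE ν k) (2 * ν₀ * besselInvSq ν₀ k) ν₀ := by
  set A : ℝ → ℝ := fun ν =>
    ∫ x in (0 : ℝ)..1, besselSol ν₀ (besselE ν₀ k) x * besselSol ν (besselE ν k) x with hA
  set B : ℝ → ℝ := fun ν =>
    ∫ x in (0 : ℝ)..1, besselSolDiv ν₀ (besselE ν₀ k) x * besselSolDiv ν (besselE ν k) x with hB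
  have hAc : ContinuousAt A ν₀ :=
    continuousAt_integral_mul (f := fun q => besselSol q.1 q.2.1 q.2.2)
      (fun p hp => continuousAt_besselSol hp) (continuous_besselSol hν₀ _) hν₀ k
  have hBc : ContinuousAt B ν₀ :=
    continuousAt_integral_mul (f := fun q => besselSolDiv q.1 q.2.1 q.2.2)
      (fun p hp => continuousAt_besselSolDiv hp) (continuous_besselSolDiv hν₀ _) hν₀ k
  have hA0 : A ν₀ ≠ 0 := (integral_besselSol_sq_pos hν₀ _).ne'
  rw [hasDerivAt_iff_tendsto_slope]
  -- The Wronskian identity between ν₀ and ν gives the difference quotient of E_k exactly as (ν +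
  -- ν₀) B/A, so continuity of E_k suffices and eigenfunctions need not be differentiated in ν.
  have hlim : Tendsto (fun ν => (ν + ν₀) * (B ν / A ν)) (𝓝[≠] ν₀)
      (𝓝 ((ν₀ + ν₀) * (B ν₀ / A ν₀))) :=
    tendsto_nhdsWithin_of_tendsto_nhds
      ((continuousAt_id.add continuousAt_const).mul (hBc.div hAc hA0))
  rw [two_mul]
  refine hlim.congr' ?_
  filter_upwards [self_mem_nhdsWithin, nhdsWithin_le_nhds (hAc.eventually_ne hA0),
    nhdsWithin_le_nhds (lt_mem_nhds hν₀)] with ν hne hAν hν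
  have h := sub_mul_integral_besselSol_mul hν₀ hν (besselSeries_besselE hν₀ k)
    (besselSeries_besselE hν k)
  have hne' : ν - ν₀ ≠ 0 := sub_ne_zero.2 hne
  rw [slope_def_field, eq_div_iff hne', ← mul_div_assoc, div_mul_eq_mul_div, div_eq_iff hAν]
  rw [show (besselE ν k - besselE ν₀ k) * A ν = _ from h]
  ring

/-! ### Integral identities for kinetic energy, position and momentum. -/

/-- Integrate (u u')' = u'² + u u''; the boundary terms vanish. This identifies E minus the mean
potential energy as a kinetic energy. -/
theorem integral_besselSolDeriv_sq {ν E : ℝ} (hν : 1 / 2 < ν) (h0 : besselSeries ν E = 0) :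
    ∫ x in (0 : ℝ)..1, besselSolDeriv ν E x * besselSolDeriv ν E x =
      E * (∫ x in (0 : ℝ)..1, besselSol ν E x * besselSol ν E x) -
      (ν ^ 2 - 1 / 4) * ∫ x in (0 : ℝ)..1, besselSolDiv ν E x * besselSolDiv ν E x := by
  have c := continuous_besselSol hν E
  have d := continuous_besselSolDeriv hν E
  have w := continuous_besselSolDiv hν E
  have key := integral_zero_one_of_hasDerivAt
    (F := fun x => besselSol ν E x * besselSolDeriv ν E x)
    (f := fun x => besselSolDeriv ν E x * besselSolDeriv ν E x -
      (E * (besselSol ν E x * besselSol ν E x) -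
        (ν ^ 2 - 1 / 4) * (besselSolDiv ν E x * besselSolDiv ν E x)))
    (by fun_prop) (by fun_prop) fun x hx => by
      refine ((hasDerivAt_besselSol hν E hx).mul
        (hasDerivAt_besselSolDeriv hν E hx)).congr_deriv ?_
      rw [besselSol_eq_mul_div hν E (le_of_lt hx)]
      have : x ≠ 0 := ne_of_gt hx
      field_simp
      ring
  rw [intervalIntegral.integral_sub ((by fun_prop : Continuous _).intervalIntegrable 0 1)
    ((by fun_prop : Continuous _).intervalIntegrable 0 1),
    intervalIntegral.integral_sub ((by fun_prop : Continuous _).intervalIntegrable 0 1)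
    ((by fun_prop : Continuous _).intervalIntegrable 0 1),
    intervalIntegral.integral_const_mul,
    intervalIntegral.integral_const_mul] at key
  simp only [besselSol_zero hν, besselSol_one, h0] at key
  linarith

/-- The commutator identity between position and momentum in terms of two eigenfunctions. -/
theorem two_mul_integral_besselSol_mul_deriv {ν E₁ E₂ : ℝ} (hν : 1 / 2 < ν)
    (h1 : besselSeries ν E₁ = 0) (h2 : besselSeries ν E₂ = 0) :
    2 * ∫ x in (0 : ℝ)..1, besselSol ν E₁ x * besselSolDeriv ν E₂ x =
      (E₂ - E₁) * ∫ x in (0 : ℝ)..1, besselSol ν E₁ x * (x * besselSol ν E₂ x) := by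
  have c1 := continuous_besselSol hν E₁
  have c2 := continuous_besselSol hν E₂
  have d1 := continuous_besselSolDeriv hν E₁
  have d2 := continuous_besselSolDeriv hν E₂
  -- The primitive is u₁u₂ - xW with W = u₁'u₂ - u₁u₂' and W' = (E₂ - E₁)u₁u₂.
  have key := integral_zero_one_of_hasDerivAt
    (F := fun x => besselSol ν E₁ x * besselSol ν E₂ x - x * (besselSolDeriv ν E₁ x *
      besselSol ν E₂ x - besselSol ν E₁ x * besselSolDeriv ν E₂ x))
    (f := fun x => 2 * (besselSol ν E₁ x * besselSolDeriv ν E₂ x) -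
      (E₂ - E₁) * (besselSol ν E₁ x * (x * besselSol ν E₂ x)))
    (by fun_prop) (by fun_prop) fun x hx => by
      refine (((hasDerivAt_besselSol hν E₁ hx).mul (hasDerivAt_besselSol hν E₂ hx)).sub
        ((hasDerivAt_id x).mul (((hasDerivAt_besselSolDeriv hν E₁ hx).mul
          (hasDerivAt_besselSol hν E₂ hx)).sub ((hasDerivAt_besselSol hν E₁ hx).mul
          (hasDerivAt_besselSolDeriv hν E₂ hx))))).congr_deriv ?_
      simp only [id, Pi.sub_apply, Pi.mul_apply]
      ring
  rw [intervalIntegral.integral_sub ((by fun_prop : Continuous _).intervalIntegrable 0 1)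
    ((by fun_prop : Continuous _).intervalIntegrable 0 1), intervalIntegral.integral_const_mul,
    intervalIntegral.integral_const_mul] at key
  simp only [besselSol_zero hν, besselSol_one, h1, h2] at key
  linarith

theorem two_mul_integral_mul_besselSol_mul_deriv {ν E : ℝ} (hν : 1 / 2 < ν)
    (h0 : besselSeries ν E = 0) :
    2 * ∫ x in (0 : ℝ)..1, (x * besselSol ν E x) * besselSolDeriv ν E x =
      -∫ x in (0 : ℝ)..1, besselSol ν E x * besselSol ν E x := by
  have c := continuous_besselSol hν E
  have d := continuous_besselSolDeriv hν E
  have key := integral_zero_one_of_hasDerivAt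
    (F := fun x => x * (besselSol ν E x * besselSol ν E x))
    (f := fun x => 2 * ((x * besselSol ν E x) * besselSolDeriv ν E x) +
      besselSol ν E x * besselSol ν E x)
    (by fun_prop) (by fun_prop) fun x hx => by
      refine ((hasDerivAt_id x).mul ((hasDerivAt_besselSol hν E hx).mul
        (hasDerivAt_besselSol hν E hx))).congr_deriv ?_
      simp only [id, Pi.mul_apply]
      ring
  rw [intervalIntegral.integral_add ((by fun_prop : Continuous _).intervalIntegrable 0 1)
    ((by fun_prop : Continuous _).intervalIntegrable 0 1),
    intervalIntegral.integral_const_mul] at key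
  simp only [besselSol_zero hν, besselSol_one, h0] at key
  linarith

/-! ### Compact symmetric integral operators on L²(0, 1). -/

/-- Pairing with a continuous family of vectors indexed by a compact space is a compact operator. -/
theorem exists_isCompactOperator_inner {X H : Type*} [TopologicalSpace X] [CompactSpace X]
    [NormedAddCommGroup H] [InnerProductSpace ℝ H] (K : C(X, H)) :
    ∃ S : H →L[ℝ] C(X, ℝ), (∀ f x, S f x = inner ℝ (K x) f) ∧ IsCompactOperator S := by
  let S₀ : H →ₗ[ℝ] C(X, ℝ) :=
    { toFun := fun f => ⟨fun x => inner ℝ (K x) f, by fun_prop⟩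
      map_add' := fun f g => by ext x; simp [inner_add_right]
      map_smul' := fun r f => by ext x; simp [inner_smul_right] }
  have hS₀ : ∀ f x, S₀ f x = inner ℝ (K x) f := fun _ _ => rfl
  let S : H →L[ℝ] C(X, ℝ) := S₀.mkContinuous ‖K‖ fun f => by
    rw [ContinuousMap.norm_le _ (by positivity)]
    intro x
    rw [hS₀]
    exact (norm_inner_le_norm _ _).trans (by gcongr; exact K.norm_coe_le_norm x)
  have hS : ∀ f x, S f x = inner ℝ (K x) f := fun _ _ => rfl
  refine ⟨S, hS, ?_⟩
  -- Arzelà–Ascoli is applied in the bounded continuous functions; the modulus `‖K x₀ - K x‖` is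
  -- common to the whole unit ball.
  let e := ContinuousMap.linearIsometryBoundedOfCompact X ℝ ℝ
  have he : ∀ φ x, e φ x = φ x := fun _ _ => rfl
  let B : H →L[ℝ] BoundedContinuousFunction X ℝ :=
    (e.toContinuousLinearEquiv : C(X, ℝ) →L[ℝ] BoundedContinuousFunction X ℝ) ∘L S
  have hBx : ∀ f x, B f x = inner ℝ (K x) f := fun _ _ => rfl
  have hB : IsCompactOperator B := by
    refine (isCompactOperator_iff_isCompact_closure_image_closedBall (B : H →ₗ[ℝ] BoundedContinuousFunction X ℝ)
      (r := 1) one_pos).2 ?_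
    refine BoundedContinuousFunction.arzela_ascoli (Metric.closedBall 0 ‖K‖)
      (isCompact_closedBall 0 ‖K‖) _ ?_ ?_
    · rintro _ x ⟨f, hf, rfl⟩
      rw [mem_closedBall_zero_iff] at hf ⊢
      calc ‖B f x‖ ≤ ‖K x‖ * ‖f‖ := by rw [hBx]; exact norm_inner_le_norm _ _
        _ ≤ ‖K‖ * 1 := by gcongr; exact K.norm_coe_le_norm x
        _ = ‖K‖ := mul_one _
    · intro x₀
      refine Metric.equicontinuousAt_of_continuity_modulus (fun x => ‖K x₀ - K x‖) ?_ _ ?_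
      · have : Continuous fun x => ‖K x₀ - K x‖ := by fun_prop
        simpa using this.tendsto x₀
      · refine Eventually.of_forall fun x => ?_
        rintro ⟨_, f, hf, rfl⟩
        rw [mem_closedBall_zero_iff] at hf
        change dist (B f x₀) (B f x) ≤ _
        rw [hBx, hBx, Real.dist_eq, ← inner_sub_left]
        calc |inner ℝ (K x₀ - K x) f| ≤ ‖K x₀ - K x‖ * ‖f‖ := abs_real_inner_le_norm _ _
          _ ≤ ‖K x₀ - K x‖ * 1 := by gcongr
          _ = _ := mul_one _
  exact hB.clm_comp
    (e.symm.toContinuousLinearEquiv : BoundedContinuousFunction X ℝ →L[ℝ] C(X, ℝ))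

/-- Real square integrable functions on the unit interval. -/
abbrev UnitL2 : Type := Lp ℝ 2 (volume : Measure I)

/-- The inclusion of continuous functions. -/
noncomputable abbrev contToL2 : C(I, ℝ) →L[ℝ] UnitL2 := ContinuousMap.toLp 2 volume ℝ

/-- The restriction of a continuous function on the line to the unit interval. -/
def restrictUnit (f : ℝ → ℝ) (hf : Continuous f) : C(I, ℝ) := ⟨fun x => f x, by fun_prop⟩

theorem integral_unitInterval (f : ℝ → ℝ) : ∫ x : I, f x = ∫ x in (0 : ℝ)..1, f x := by
  rw [intervalIntegral.integral_of_le zero_le_one, ← integral_Icc_eq_integral_Ioc]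
  exact integral_subtype_comap measurableSet_Icc f

theorem inner_contToL2 (φ ψ : C(I, ℝ)) :
    inner ℝ (contToL2 φ) (contToL2 ψ) = ∫ x : I, φ x * ψ x := by
  rw [ContinuousMap.inner_toLp]
  simp [mul_comm]

theorem inner_restrictUnit {f g : ℝ → ℝ} (hf : Continuous f) (hg : Continuous g) :
    inner ℝ (contToL2 (restrictUnit f hf)) (contToL2 (restrictUnit g hg)) =
      ∫ x in (0 : ℝ)..1, f x * g x := by
  rw [inner_contToL2, ← integral_unitInterval]
  rfl

theorem denseRange_contToL2 : DenseRange contToL2 :=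
  ContinuousMap.toLp_denseRange ℝ volume ℝ ENNReal.ofNat_ne_top

/-- The integral operator with a continuous symmetric kernel is compact and symmetric. -/
theorem exists_compact_symmetric_of_kernel (G : C(I × I, ℝ)) (hG : ∀ x y, G (x, y) = G (y, x)) :
    ∃ S : UnitL2 →L[ℝ] C(I, ℝ), (∀ φ x, S (contToL2 φ) x = ∫ y : I, G (x, y) * φ y) ∧
      IsCompactOperator (contToL2 ∘L S) ∧ (contToL2 ∘L S).IsSymmetric := by
  let K : C(I, UnitL2) := ⟨fun x => contToL2 (G.curry x), by fun_prop⟩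
  obtain ⟨S, hS, hcomp⟩ := exists_isCompactOperator_inner K
  have hSφ : ∀ φ x, S (contToL2 φ) x = ∫ y : I, G (x, y) * φ y := fun φ x => by
    rw [hS]
    exact inner_contToL2 (G.curry x) φ
  refine ⟨S, hSφ, hcomp.clm_comp contToL2, fun f g => ?_⟩
  -- By density it suffices to test on continuous functions, where Fubini and the symmetry of the
  -- kernel apply.
  refine denseRange_contToL2.induction_on₂
    (p := fun f g => inner ℝ ((contToL2 ∘L S) f) g = inner ℝ f ((contToL2 ∘L S) g)) ?_ ?_ f g
  · exact isClosed_eq (by fun_prop) (by fun_prop)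
  · intro φ ψ
    simp only [ContinuousLinearMap.comp_apply]
    rw [inner_contToL2, inner_contToL2]
    simp_rw [hSφ]
    simp_rw [← integral_mul_const, ← integral_const_mul]
    rw [integral_integral_swap]
    · refine integral_congr_ae (Eventually.of_forall fun y => ?_)
      refine integral_congr_ae (Eventually.of_forall fun x => ?_)
      simp only
      rw [hG x y]
      ring
    · exact Continuous.integrable_of_hasCompactSupport (by fun_prop)
        (HasCompactSupport.of_compactSpace _)

/-- The multiples of a fixed continuous function with almost no zeros by polynomials have trivial
orthogonal complement. -/
theorem eq_zero_of_inner_mul_polynomial {q : C(I, ℝ)} (hq : ∀ᵐ x : I, q x ≠ 0) {f : UnitL2}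
    (h : ∀ P : Polynomial ℝ, inner ℝ f (contToL2 (q * P.toContinuousMapOn I)) = 0) : f = 0 := by
  -- By Weierstrass the polynomials may be replaced by all continuous functions; then `q f` is
  -- orthogonal to a dense set.
  have hall : ∀ φ : C(I, ℝ), inner ℝ f (contToL2 (q * φ)) = 0 := by
    have hclosed : IsClosed {φ : C(I, ℝ) | inner ℝ f (contToL2 (q * φ)) = 0} :=
      isClosed_eq (by fun_prop) continuous_const
    intro φ
    have hφ : φ ∈ (polynomialFunctions I).topologicalClosure := by
      rw [polynomialFunctions_closure_eq_top']; trivial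
    refine closure_minimal ?_ hclosed hφ
    rintro _ ⟨P, -, rfl⟩
    exact h P
  have hmem : MemLp (fun x => q x * f x) 2 (volume : Measure I) := by
    refine (Lp.memLp f).of_le_mul (c := ‖q‖)
      (q.continuous.aestronglyMeasurable.mul (Lp.aestronglyMeasurable f)) ?_
    refine Eventually.of_forall fun x => ?_
    rw [norm_mul]
    gcongr
    exact q.norm_coe_le_norm x
  have hF : hmem.toLp = 0 := by
    refine denseRange_contToL2.eq_zero_of_inner_left ℝ ?_
    intro φ
    rw [← hall φ, L2.inner_def, L2.inner_def]
    refine integral_congr_ae ?_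
    filter_upwards [hmem.coeFn_toLp, ContinuousMap.coeFn_toLp (𝕜 := ℝ) (p := 2) volume φ,
      ContinuousMap.coeFn_toLp (𝕜 := ℝ) (p := 2) volume (q * φ)] with x h1 h2 h3
    rw [h1, h2, h3]
    simp
    ring
  rw [Lp.eq_zero_iff_ae_eq_zero] at hF ⊢
  filter_upwards [hF, hmem.coeFn_toLp, hq] with x h1 h2 h3
  rw [h2] at h1
  exact (mul_eq_zero.1 h1).resolve_left h3

/-! ### The Green function. -/

/-- The Green function of `-u'' + ((ν² - 1/4)/x²) u` with Dirichlet conditions on `[0, 1]`. -/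
noncomputable def besselGreen (ν x y : ℝ) : ℝ :=
  (2 * ν)⁻¹ * (min x y * (min x y / max x y) ^ (ν - 1 / 2) - (x * y) ^ (ν + 1 / 2))

theorem besselGreen_comm (ν x y : ℝ) : besselGreen ν x y = besselGreen ν y x := by
  rw [besselGreen, besselGreen, min_comm, max_comm, mul_comm x y]

/-- The only delicate point is the corner (0, 0), where the ratio min/max has no limit; its power is
at most 1, so the prefactor min forces the limit 0. -/
theorem continuous_besselGreen {ν : ℝ} (hν : 1 / 2 < ν) :
    Continuous fun p : I × I => besselGreen ν p.1 p.2 := by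
  unfold besselGreen
  refine continuous_const.mul (Continuous.sub ?_ ?_)
  · refine continuous_iff_continuousAt.2 fun p => ?_
    by_cases hp : max (p.1 : ℝ) p.2 = 0
    · have hp1 : (p.1 : ℝ) = 0 := le_antisymm (hp ▸ le_max_left _ _) p.1.2.1
      have hp2 : (p.2 : ℝ) = 0 := le_antisymm (hp ▸ le_max_right _ _) p.2.2.1
      have hmin : Tendsto (fun q : I × I => min (q.1 : ℝ) q.2) (𝓝 p) (𝓝 0) := by
        have : Continuous fun q : I × I => min (q.1 : ℝ) q.2 := by fun_prop
        simpa [hp1, hp2] using this.tendsto p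
      rw [ContinuousAt, hp1, hp2]
      simp only [min_self, zero_mul]
      refine squeeze_zero (fun q => ?_) (fun q => ?_) hmin
      · have := le_min q.1.2.1 q.2.2.1
        have := q.1.2.1.trans (le_max_left (q.1 : ℝ) q.2)
        positivity
      · have h0 := le_min q.1.2.1 q.2.2.1
        have h1 := q.1.2.1.trans (le_max_left (q.1 : ℝ) q.2)
        refine mul_le_of_le_one_right h0 (Real.rpow_le_one (div_nonneg h0 h1) ?_ (by linarith))
        exact div_le_one_of_le₀ min_le_max h1
    · refine ContinuousAt.mul (by fun_prop) (ContinuousAt.rpow ?_ (by fun_prop) (Or.inr ?_))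
      · exact ContinuousAt.div (by fun_prop) (by fun_prop) hp
      · linarith
  · exact Continuous.rpow_const (by fun_prop) fun _ => Or.inr (by linarith)

theorem besselGreen_zero_left {ν y : ℝ} (hν : 1 / 2 < ν) (hy : 0 ≤ y) : besselGreen ν 0 y = 0 := by
  rw [besselGreen, min_eq_left hy, zero_mul, zero_mul, Real.zero_rpow (by linarith)]
  simp

/-- The decreasing solution at zero energy which vanishes at `1`. -/
noncomputable def besselZeroSol (ν x : ℝ) : ℝ := x ^ (1 / 2 - ν) - x ^ (ν + 1 / 2)

theorem besselGreen_of_le {ν x y : ℝ} (hν : 1 / 2 < ν) (hy : 0 ≤ y) (hyx : y ≤ x) (hx : 0 < x) :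
    besselGreen ν x y = (2 * ν)⁻¹ * (besselZeroSol ν x * y ^ (ν + 1 / 2)) := by
  rw [besselGreen, min_eq_right hyx, max_eq_left hyx, besselZeroSol, Real.mul_rpow hx.le hy,
    Real.div_rpow hy hx.le, sub_mul]
  congr 2
  rcases hy.eq_or_lt with rfl | hy0
  · rw [Real.zero_rpow (show ν + 1 / 2 ≠ 0 by linarith)]; simp
  · rw [show ν + 1 / 2 = 1 + (ν - 1 / 2) by ring, Real.rpow_add hy0, Real.rpow_one,
      show 1 / 2 - ν = -(ν - 1 / 2) by ring, Real.rpow_neg hx.le]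
    field_simp

theorem besselGreen_of_ge {ν x y : ℝ} (hν : 1 / 2 < ν) (hx : 0 < x) (hxy : x ≤ y) :
    besselGreen ν x y = (2 * ν)⁻¹ * (x ^ (ν + 1 / 2) * besselZeroSol ν y) := by
  rw [besselGreen_comm, besselGreen_of_le hν hx.le hxy (hx.trans_le hxy), mul_comm (_ ^ _)]

theorem continuousAt_besselZeroSol {ν x : ℝ} (hx : 0 < x) :
    ContinuousAt (besselZeroSol ν) x :=
  (Real.continuousAt_rpow_const _ _ (Or.inl hx.ne')).sub
    (Real.continuousAt_rpow_const _ _ (Or.inl hx.ne'))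

theorem hasDerivAt_rpow_deriv {x : ℝ} (hx : 0 < x) (a : ℝ) :
    HasDerivAt (fun x : ℝ => a * x ^ (a - 1)) (a * (a - 1) / x ^ 2 * x ^ a) x := by
  refine ((Real.hasDerivAt_rpow_const (p := a - 1) (Or.inl hx.ne')).const_mul a).congr_deriv ?_
  rw [show a - 1 - 1 = a - 2 by ring, Real.rpow_sub hx]
  norm_num
  ring

theorem integral_besselGreen_eq {ν x : ℝ} (hν : 1 / 2 < ν) {f : ℝ → ℝ} (hf : Continuous f)
    (hx : x ∈ Ioo (0 : ℝ) 1) :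
    ∫ y in (0 : ℝ)..1, besselGreen ν x y * f y =
      (2 * ν)⁻¹ * (besselZeroSol ν x * (∫ y in (0 : ℝ)..x, y ^ (ν + 1 / 2) * f y) +
        x ^ (ν + 1 / 2) * ∫ y in x..1, besselZeroSol ν y * f y) := by
  have hpow : Continuous fun x : ℝ => x ^ (ν + 1 / 2) := Real.continuous_rpow_const (by linarith)
  have hb : ContinuousOn (fun y => besselZeroSol ν y * f y) (uIcc x 1) := by
    rw [uIcc_of_le hx.2.le]
    exact fun y hy => ((continuousAt_besselZeroSol (hx.1.trans_le hy.1)).mul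
      hf.continuousAt).continuousWithinAt
  have e1 : ∀ y ∈ uIcc 0 x, besselGreen ν x y * f y =
      (2 * ν)⁻¹ * besselZeroSol ν x * (y ^ (ν + 1 / 2) * f y) := fun y hy => by
    rw [uIcc_of_le hx.1.le] at hy
    rw [besselGreen_of_le hν hy.1 hy.2 hx.1]; ring
  have e2 : ∀ y ∈ uIcc x 1, besselGreen ν x y * f y =
      (2 * ν)⁻¹ * x ^ (ν + 1 / 2) * (besselZeroSol ν y * f y) := fun y hy => by
    rw [uIcc_of_le hx.2.le] at hy
    rw [besselGreen_of_ge hν hx.1 hy.1]; ring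
  have i1 : IntervalIntegrable (fun y => besselGreen ν x y * f y) volume 0 x := by
    refine ContinuousOn.intervalIntegrable (ContinuousOn.congr ?_ e1)
    exact (by fun_prop : Continuous _).continuousOn
  have i2 : IntervalIntegrable (fun y => besselGreen ν x y * f y) volume x 1 :=
    ContinuousOn.intervalIntegrable (ContinuousOn.congr (hb.const_mul _) e2)
  rw [← intervalIntegral.integral_add_adjacent_intervals i1 i2,
    intervalIntegral.integral_congr e1, intervalIntegral.integral_congr e2,
    intervalIntegral.integral_const_mul, intervalIntegral.integral_const_mul]
  ring

/-- The Green function inverts the differential operator. -/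
theorem exists_hasDerivAt_integral_besselGreen {ν : ℝ} (hν : 1 / 2 < ν) {f : ℝ → ℝ}
    (hf : Continuous f) :
    ∃ U' : ℝ → ℝ, ∀ x ∈ Ioo (0 : ℝ) 1,
      HasDerivAt (fun x => ∫ y in (0 : ℝ)..1, besselGreen ν x y * f y) (U' x) x ∧
      HasDerivAt U' ((ν ^ 2 - 1 / 4) / x ^ 2 *
        (∫ y in (0 : ℝ)..1, besselGreen ν x y * f y) - f x) x := by
  have hpow : Continuous fun x : ℝ => x ^ (ν + 1 / 2) := Real.continuous_rpow_const (by linarith)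
  set A : ℝ → ℝ := fun x => ∫ y in (0 : ℝ)..x, y ^ (ν + 1 / 2) * f y with hA
  set B : ℝ → ℝ := fun x => ∫ y in x..1, besselZeroSol ν y * f y with hB
  set b' : ℝ → ℝ := fun x =>
    (1 / 2 - ν) * x ^ (1 / 2 - ν - 1) - (ν + 1 / 2) * x ^ (ν + 1 / 2 - 1) with hb'
  set a' : ℝ → ℝ := fun x => (ν + 1 / 2) * x ^ (ν + 1 / 2 - 1) with ha'
  have dA : ∀ x, HasDerivAt A (x ^ (ν + 1 / 2) * f x) x := fun x =>
    ((hpow.mul hf).integral_hasStrictDerivAt 0 x).hasDerivAt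
  have dB : ∀ x ∈ Ioo (0 : ℝ) 1, HasDerivAt B (-(besselZeroSol ν x * f x)) x := fun x hx => by
    have hc : ContinuousOn (fun y => besselZeroSol ν y * f y) (Ioi 0) := fun y hy =>
      ((continuousAt_besselZeroSol hy).mul hf.continuousAt).continuousWithinAt
    refine intervalIntegral.integral_hasDerivAt_left ?_ ?_ ?_
    · refine (hc.mono fun y hy => ?_).intervalIntegrable
      rw [uIcc_of_le hx.2.le] at hy
      exact hx.1.trans_le hy.1
    · exact hc.stronglyMeasurableAtFilter isOpen_Ioi x hx.1
    · exact hc.continuousAt (Ioi_mem_nhds hx.1)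
  have db : ∀ x > 0, HasDerivAt (besselZeroSol ν) (b' x) x := fun x hx =>
    (Real.hasDerivAt_rpow_const (Or.inl (ne_of_gt hx))).sub
      (Real.hasDerivAt_rpow_const (Or.inl (ne_of_gt hx)))
  have da : ∀ x > 0, HasDerivAt (fun x : ℝ => x ^ (ν + 1 / 2)) (a' x) x := fun x hx =>
    Real.hasDerivAt_rpow_const (Or.inl (ne_of_gt hx))
  have dda : ∀ x > 0, HasDerivAt a' ((ν ^ 2 - 1 / 4) / x ^ 2 * x ^ (ν + 1 / 2)) x := fun x hx =>
    (hasDerivAt_rpow_deriv hx _).congr_deriv (by ring)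
  have ddb : ∀ x > 0, HasDerivAt b' ((ν ^ 2 - 1 / 4) / x ^ 2 * besselZeroSol ν x) x :=
    fun x hx => ((hasDerivAt_rpow_deriv hx _).sub (hasDerivAt_rpow_deriv hx _)).congr_deriv (by
      rw [besselZeroSol]; ring)
  -- The Wronskian of the two zero-energy solutions is the constant -2ν; divided by 2ν it produces
  -- the source term -f.
  have hW : ∀ x > 0, b' x * x ^ (ν + 1 / 2) - a' x * besselZeroSol ν x = -(2 * ν) := by
    intro x hx
    have h1 : x ^ (1 / 2 - ν - 1) = (x ^ (ν + 1 / 2))⁻¹ := by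
      rw [← Real.rpow_neg (le_of_lt hx)]; congr 1; ring
    have h2 : x ^ (ν + 1 / 2 - 1) = x ^ (ν + 1 / 2) / x := by
      rw [Real.rpow_sub hx, Real.rpow_one]
    have h3 : x ^ (1 / 2 - ν) = x / x ^ (ν + 1 / 2) := by
      rw [show 1 / 2 - ν = 1 - (ν + 1 / 2) by ring, Real.rpow_sub hx, Real.rpow_one]
    have h4 : x ^ (ν + 1 / 2) ≠ 0 := (Real.rpow_pos_of_pos hx _).ne'
    have h5 : x ≠ 0 := ne_of_gt hx
    simp only [hb', ha', besselZeroSol, h1, h2, h3]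
    field_simp
    ring
  refine ⟨fun x => (2 * ν)⁻¹ * (b' x * A x + a' x * B x), fun x hx => ⟨?_, ?_⟩⟩
  · have heq : (fun x => ∫ y in (0 : ℝ)..1, besselGreen ν x y * f y) =ᶠ[𝓝 x]
        fun x => (2 * ν)⁻¹ * (besselZeroSol ν x * A x + x ^ (ν + 1 / 2) * B x) := by
      filter_upwards [Ioo_mem_nhds hx.1 hx.2] with z hz using integral_besselGreen_eq hν hf hz
    refine HasDerivAt.congr_of_eventuallyEq ?_ heq
    refine ((((db x hx.1).mul (dA x)).add ((da x hx.1).mul (dB x hx))).const_mul _).congr_deriv ?_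
    ring
  · rw [integral_besselGreen_eq hν hf hx]
    refine ((((ddb x hx.1).mul (dA x)).add ((dda x hx.1).mul (dB x hx))).const_mul _).congr_deriv ?_
    have h1 := hW x hx.1
    have h2 : 2 * ν ≠ 0 := by linarith
    have h3 : (2 * ν)⁻¹ * (b' x * x ^ (ν + 1 / 2) - a' x * besselZeroSol ν x) = -1 := by
      rw [h1]; field_simp
    change _ = (ν ^ 2 - 1 / 4) / x ^ 2 * ((2 * ν)⁻¹ * (besselZeroSol ν x * A x +
      x ^ (ν + 1 / 2) * B x)) - f x
    linear_combination f x * h3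

theorem integral_besselGreen_zero {ν : ℝ} (hν : 1 / 2 < ν) (f : ℝ → ℝ) :
    ∫ y in (0 : ℝ)..1, besselGreen ν 0 y * f y = 0 := by
  rw [intervalIntegral.integral_congr (g := fun _ => 0)]
  · simp
  · intro y hy
    rw [uIcc_of_le zero_le_one] at hy
    simp [besselGreen_zero_left hν hy.1]

theorem integral_besselGreen_one {ν : ℝ} (hν : 1 / 2 < ν) (f : ℝ → ℝ) :
    ∫ y in (0 : ℝ)..1, besselGreen ν 1 y * f y = 0 := by
  rw [intervalIntegral.integral_congr (g := fun _ => 0)]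
  · simp
  · intro y hy
    rw [uIcc_of_le zero_le_one] at hy
    simp [besselGreen_of_le hν hy.1 hy.2 one_pos, besselZeroSol]

/-- The Green function as a continuous map. -/
noncomputable def besselGreenMap {ν : ℝ} (hν : 1 / 2 < ν) : C(I × I, ℝ) :=
  ⟨fun p => besselGreen ν p.1 p.2, continuous_besselGreen hν⟩

theorem integral_besselGreenMap {ν : ℝ} (hν : 1 / 2 < ν) (f : ℝ → ℝ) (x : I) :
    ∫ y : I, besselGreenMap hν (x, y) * f y = ∫ y in (0 : ℝ)..1, besselGreen ν x y * f y :=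
  integral_unitInterval fun y => besselGreen ν x y * f y

/-- The kernel operator takes values in `C(I, ℝ)`, so continuity up to the endpoints is automatic.
-/
theorem continuousOn_integral_besselGreen {ν : ℝ} (hν : 1 / 2 < ν) {f : ℝ → ℝ}
    (hf : Continuous f) :
    ContinuousOn (fun x => ∫ y in (0 : ℝ)..1, besselGreen ν x y * f y) (Icc 0 1) := by
  obtain ⟨S, hS, -, -⟩ := exists_compact_symmetric_of_kernel (besselGreenMap hν)
    fun x y => besselGreen_comm ν x y
  rw [continuousOn_iff_continuous_domRestrict]
  refine (S (contToL2 (restrictUnit f hf))).continuous.congr fun x => ?_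
  rw [hS]
  exact integral_besselGreenMap hν f x

/-- Both sides solve the same boundary value problem; for their difference the constant 1 is a
strict supersolution. -/
theorem eq_integral_besselGreen {ν : ℝ} (hν : 1 / 2 < ν) {f g g' : ℝ → ℝ} (hf : Continuous f)
    (hg : Continuous g) (h0 : g 0 = 0) (h1 : g 1 = 0)
    (hg' : ∀ x ∈ Ioo (0 : ℝ) 1, HasDerivAt g (g' x) x)
    (hg'' : ∀ x ∈ Ioo (0 : ℝ) 1, HasDerivAt g' ((ν ^ 2 - 1 / 4) / x ^ 2 * g x - f x) x) :
    ∀ x ∈ Icc (0 : ℝ) 1, ∫ y in (0 : ℝ)..1, besselGreen ν x y * f y = g x := by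
  obtain ⟨U', hU⟩ := exists_hasDerivAt_integral_besselGreen hν hf
  have hc := sq_sub_quarter_pos hν
  intro x hx
  refine sub_eq_zero.1 (eq_zero_of_strict_supersolution (Q := fun x => (ν ^ 2 - 1 / 4) / x ^ 2)
    (u := fun x => (∫ y in (0 : ℝ)..1, besselGreen ν x y * f y) - g x)
    (u' := fun x => U' x - g' x)
    (s := fun _ => 1) (s' := fun _ => 0) (s'' := fun _ => 0)
    ((continuousOn_integral_besselGreen hν hf).sub hg.continuousOn) (by fun_prop)
    (fun _ _ => one_pos) (by rw [integral_besselGreen_zero hν, h0, sub_zero])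
    (by rw [integral_besselGreen_one hν, h1, sub_zero])
    (fun y hy => (hU y hy).1.sub (hg' y hy))
    (fun y hy => ((hU y hy).2.sub (hg'' y hy)).congr_deriv (by ring))
    (fun y _ => hasDerivAt_const y _) (fun y _ => hasDerivAt_const y _) (fun y hy => ?_) x hx)
  have : 0 < y := hy.1
  simp only [mul_one]
  positivity

/-! ### Completeness of the eigenfunctions. -/

/-- The span of the eigenfunctions has trivial orthogonal complement. -/
theorem orthogonal_span_besselSol {ν : ℝ} (hν : 1 / 2 < ν) :
    (Submodule.span ℝ (range fun k : ℕ => contToL2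
      (restrictUnit (besselSol ν (besselE ν k)) (continuous_besselSol hν _))))ᗮ = ⊥ := by
  obtain ⟨S, hS, hcomp, hsymm⟩ := exists_compact_symmetric_of_kernel (besselGreenMap hν)
    fun x y => besselGreen_comm ν x y
  set T := contToL2 ∘L S with hT
  have hTS : ∀ f, T f = contToL2 (S f) := fun _ => rfl
  have hSf : ∀ (f : ℝ → ℝ) (hf : Continuous f) (x : I), S (contToL2 (restrictUnit f hf)) x =
      ∫ y in (0 : ℝ)..1, besselGreen ν x y * f y := fun f hf x => by
    rw [hS]
    exact integral_besselGreenMap hν f x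
  -- Injectivity: for g = x³(1 - x)P the function -g'' + (ν² - 1/4)g/x² is a polynomial, so `g` lies
  -- in the range of `T`. By symmetry the kernel of `T` is orthogonal to all such `g`.
  have hker : ∀ f, T f = 0 → f = 0 := by
    intro f hf
    let q : ℝ → ℝ := fun x => x ^ 3 * (1 - x)
    have hqc : Continuous q := by fun_prop
    refine eq_zero_of_inner_mul_polynomial (q := restrictUnit q hqc) ?_ fun P => ?_
    · have hfin : ({0, 1} : Set I).Finite := by simp
      have hae : ∀ᵐ x : I, x ∉ ({0, 1} : Set I) :=
        (hfin.countable.measure_zero volume : volume ({0, 1} : Set I) = 0) |> measure_eq_zero_iff_ae_notMem.1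
      filter_upwards [hae] with x hx
      simp only [mem_insert_iff, mem_singleton_iff, not_or] at hx
      have h0 : (x : ℝ) ≠ 0 := fun h => hx.1 (Subtype.ext h)
      have h1 : (1 : ℝ) - x ≠ 0 := fun h => hx.2 (Subtype.ext (sub_eq_zero.1 h).symm)
      exact mul_ne_zero (pow_ne_zero 3 h0) h1
    · let p : Polynomial ℝ := Polynomial.X ^ 3 * (1 - Polynomial.X) * P
      let h : ℝ → ℝ := fun x => (ν ^ 2 - 1 / 4) * (x * (1 - x) * P.eval x) -
        p.derivative.derivative.eval x
      have hh : Continuous h := by fun_prop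
      have heval : ∀ x, p.eval x = q x * P.eval x := fun x => by simp [p, q]
      have hsol := eq_integral_besselGreen hν (f := h) (g := fun x => p.eval x)
        (g' := fun x => p.derivative.eval x) hh (by fun_prop) (by simp [p]) (by simp [p])
        (fun x _ => p.hasDerivAt x) fun x hx => by
          refine (p.derivative.hasDerivAt x).congr_deriv ?_
          have : x ≠ 0 := hx.1.ne'
          simp only [h, heval, q]
          field_simp
          ring
      have hTh : T (contToL2 (restrictUnit h hh)) =
          contToL2 (restrictUnit q hqc * P.toContinuousMapOn I) := by
        rw [hTS]
        congr 1
        ext x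
        rw [hSf, hsol x x.2, heval]
        rfl
      rw [← hTh]
      refine (hsymm f _).symm.trans ?_
      rw [ContinuousLinearMap.coe_coe, hf, inner_zero_left]
  -- By the spectral theorem it is enough to place each eigenvector of `T` in the span. For μ ≠ 0 it
  -- is represented by a continuous function solving the Dirichlet problem with eigenvalue μ⁻¹.
  rw [eq_bot_iff,
    ← ContinuousLinearMap.orthogonalComplement_iSup_eigenspaces_eq_bot hcomp hsymm]
  refine Submodule.orthogonal_le (iSup_le fun μ f hf => ?_)
  rw [Module.End.mem_eigenspace_iff] at hf
  replace hf : T f = μ • f := hf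
  by_cases hf0 : f = 0
  · rw [hf0]; exact Submodule.zero_mem _
  have hμ : μ ≠ 0 := by
    rintro rfl
    exact hf0 (hker f (by rw [hf, zero_smul]))
  set φ : C(I, ℝ) := μ⁻¹ • S f with hφ
  have hfφ : f = contToL2 φ := by
    rw [hφ, map_smul, ← hTS, hf, smul_smul, inv_mul_cancel₀ hμ, one_smul]
  let u : ℝ → ℝ := IccExtend zero_le_one φ
  have hu : Continuous u := φ.continuous.Icc_extend'
  have hφu : φ = restrictUnit u hu := by
    ext x
    exact (IccExtend_val zero_le_one φ x).symm
  have huU : ∀ x ∈ Icc (0 : ℝ) 1, u x = μ⁻¹ * ∫ y in (0 : ℝ)..1, besselGreen ν x y * u y := by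
    intro x hx
    rw [← hSf u hu ⟨x, hx⟩, ← hφu, ← hfφ]
    exact IccExtend_of_mem zero_le_one φ hx
  obtain ⟨U', hU⟩ := exists_hasDerivAt_integral_besselGreen hν hu
  have hd : ∀ x ∈ Ioo (0 : ℝ) 1, HasDerivAt u (μ⁻¹ * U' x) x := fun x hx => by
    refine ((hU x hx).1.const_mul μ⁻¹).congr_of_eventuallyEq ?_
    filter_upwards [Ioo_mem_nhds hx.1 hx.2] with z hz using huU z (Ioo_subset_Icc_self hz)
  have hdd : ∀ x ∈ Ioo (0 : ℝ) 1, HasDerivAt (deriv u)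
      ((ν ^ 2 - 1 / 4) / x ^ 2 * u x - μ⁻¹ * u x) x := fun x hx => by
    have h1 : deriv u =ᶠ[𝓝 x] fun x => μ⁻¹ * U' x := by
      filter_upwards [Ioo_mem_nhds hx.1 hx.2] with z hz using (hd z hz).deriv
    refine (((hU x hx).2.const_mul μ⁻¹).congr_of_eventuallyEq h1).congr_deriv ?_
    linear_combination -((ν ^ 2 - 1 / 4) / x ^ 2) * huU x (Ioo_subset_Icc_self hx)
  have heig : IsBesselDirichletEigenfunction ν μ⁻¹ u := by
    refine ⟨hu.continuousOn, fun x hx => (hd x hx).differentiableAt.differentiableWithinAt,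
      fun x hx => (hdd x hx).differentiableAt.differentiableWithinAt, fun x hx => ?_, ?_, ?_, ?_⟩
    · rw [(hdd x hx).deriv]; ring
    · rw [huU 0 ⟨le_rfl, zero_le_one⟩, integral_besselGreen_zero hν, mul_zero]
    · rw [huU 1 ⟨zero_le_one, le_rfl⟩, integral_besselGreen_one hν, mul_zero]
    · by_contra! hall
      have hall' : EqOn u (fun _ => 0) (Icc 0 1) :=
        EqOn.of_subset_closure (s := Ioo 0 1) hall hu.continuousOn continuousOn_const
          Ioo_subset_Icc_self (by rw [closure_Ioo zero_ne_one])
      refine hf0 ?_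
      rw [hfφ, hφu, show restrictUnit u hu = 0 from ContinuousMap.ext fun x => hall' x.2, map_zero]
  obtain ⟨r, -, hr⟩ := heig.eq_mul_besselSol hν
  have hmem : μ⁻¹ ∈ range (besselE ν) := by
    rw [range_besselE hν]; exact ⟨u, heig⟩
  obtain ⟨k, hk⟩ := hmem
  have : f = r • contToL2
      (restrictUnit (besselSol ν (besselE ν k)) (continuous_besselSol hν _)) := by
    rw [hfφ, hφu, ← map_smul]
    congr 1
    ext x
    change u x = r * besselSol ν (besselE ν k) x
    rw [hk, hr x x.2]
  rw [this]
  exact Submodule.smul_mem _ _ (Submodule.subset_span ⟨k, rfl⟩)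

/-- The squared norm of the `k`-th regular eigenfunction. -/
noncomputable def besselNormSq (ν : ℝ) (k : ℕ) : ℝ :=
  ∫ x in (0 : ℝ)..1, besselSol ν (besselE ν k) x * besselSol ν (besselE ν k) x

theorem besselNormSq_pos {ν : ℝ} (hν : 1 / 2 < ν) (k : ℕ) : 0 < besselNormSq ν k :=
  integral_besselSol_sq_pos hν _

/-- The normalized eigenfunctions form a Hilbert basis. -/
theorem exists_hilbertBasis_besselSol {ν : ℝ} (hν : 1 / 2 < ν) :
    ∃ b : HilbertBasis ℕ ℝ UnitL2, ∀ k, b k = (√(besselNormSq ν k))⁻¹ •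
      contToL2 (restrictUnit (besselSol ν (besselE ν k)) (continuous_besselSol hν _)) := by
  set e : ℕ → UnitL2 := fun k =>
    contToL2 (restrictUnit (besselSol ν (besselE ν k)) (continuous_besselSol hν _)) with he
  have horth : Orthonormal ℝ fun k => (√(besselNormSq ν k))⁻¹ • e k := by
    rw [orthonormal_iff_ite]
    intro j k
    rw [real_inner_smul_left, real_inner_smul_right, he, inner_restrictUnit]
    split_ifs with hjk
    · subst hjk
      have hN := besselNormSq_pos hν j
      change (√(besselNormSq ν j))⁻¹ * ((√(besselNormSq ν j))⁻¹ * besselNormSq ν j) = 1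
      have h1 := Real.sqrt_ne_zero'.2 hN
      field_simp
      exact (Real.sq_sqrt hN.le).symm
    -- With equal parameters ν the Wronskian identity gives orthogonality for distinct eigenvalues.
    · have h := sub_mul_integral_besselSol_mul hν hν (besselSeries_besselE hν j)
        (besselSeries_besselE hν k)
      rw [sub_self, zero_mul, mul_eq_zero] at h
      rw [h.resolve_left (sub_ne_zero.2 fun h => hjk ((strictMono_besselE hν).injective h.symm)),
        mul_zero, mul_zero]
  refine ⟨HilbertBasis.mkOfOrthogonalEqBot horth ?_, fun k => by
    rw [HilbertBasis.coe_mkOfOrthogonalEqBot]⟩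
  rw [eq_bot_iff, ← orthogonal_span_besselSol hν]
  refine Submodule.orthogonal_le (Submodule.span_le.2 ?_)
  rintro _ ⟨k, rfl⟩
  have h1 := Real.sqrt_ne_zero'.2 (besselNormSq_pos hν k)
  have h2 : e k = √(besselNormSq ν k) • ((√(besselNormSq ν k))⁻¹ • e k) := by
    rw [smul_smul, mul_inv_cancel₀ h1, one_smul]
  change e k ∈ _
  rw [h2]
  exact Submodule.smul_mem _ _ (Submodule.subset_span ⟨k, rfl⟩)

/-! ### The sum rules. -/

/-- The mean kinetic energy of the `k`-th eigenfunction. -/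
noncomputable def besselKinetic (ν : ℝ) (k : ℕ) : ℝ :=
  besselE ν k - (ν ^ 2 - 1 / 4) * besselInvSq ν k

theorem besselInvSq_nonneg {ν : ℝ} (hν : 1 / 2 < ν) (k : ℕ) : 0 ≤ besselInvSq ν k :=
  div_nonneg (intervalIntegral.integral_nonneg zero_le_one fun _ _ => mul_self_nonneg _)
    (besselNormSq_pos hν k).le

theorem besselKinetic_eq {ν : ℝ} (hν : 1 / 2 < ν) (k : ℕ) :
    besselKinetic ν k = (∫ x in (0 : ℝ)..1,
      besselSolDeriv ν (besselE ν k) x * besselSolDeriv ν (besselE ν k) x) / besselNormSq ν k := by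
  have hN := (besselNormSq_pos hν k).ne'
  rw [integral_besselSolDeriv_sq hν (besselSeries_besselE hν k), besselKinetic, besselInvSq]
  change _ - _ * (_ / besselNormSq ν k) = (_ * besselNormSq ν k - _) / _
  field_simp

theorem besselKinetic_nonneg {ν : ℝ} (hν : 1 / 2 < ν) (k : ℕ) : 0 ≤ besselKinetic ν k := by
  rw [besselKinetic_eq hν]
  exact div_nonneg (intervalIntegral.integral_nonneg zero_le_one fun _ _ => mul_self_nonneg _)
    (besselNormSq_pos hν k).le

theorem besselKinetic_le {ν : ℝ} (hν : 1 / 2 < ν) (k : ℕ) : besselKinetic ν k ≤ besselE ν k :=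
  sub_le_self _ (mul_nonneg (sq_sub_quarter_pos hν).le (besselInvSq_nonneg hν k))

/-- The Thomas–Reiche–Kuhn sum rule and its companion of second order; `a j k` is the square of
the matrix element of the position between the eigenfunctions `j` and `k`. -/
theorem exists_position_matrix {ν : ℝ} (hν : 1 / 2 < ν) :
    ∃ a : ℕ → ℕ → ℝ, (∀ j k, 0 ≤ a j k) ∧ (∀ j k, a j k = a k j) ∧
      (∀ j, HasSum (fun k => (besselE ν k - besselE ν j) * a j k) 1) ∧
      ∀ j, HasSum (fun k => (besselE ν k - besselE ν j) ^ 2 * a j k) (4 * besselKinetic ν j) := by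
  obtain ⟨b, hb⟩ := exists_hilbertBasis_besselSol hν
  set E := besselE ν with hE
  have hv : ∀ k, Continuous (besselSol ν (E k)) := fun k => continuous_besselSol hν _
  have hxv : ∀ k, Continuous fun x => x * besselSol ν (E k) x := fun k =>
    continuous_id.mul (hv k)
  have hd : ∀ k, Continuous (besselSolDeriv ν (E k)) := fun k => continuous_besselSolDeriv hν _
  set n : ℕ → ℝ := fun k => (√(besselNormSq ν k))⁻¹ with hn
  have hnn : ∀ k, n k * n k = (besselNormSq ν k)⁻¹ := fun k => by
    rw [hn, ← mul_inv, Real.mul_self_sqrt (besselNormSq_pos hν k).le]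
  have hbn : ∀ k, b k = n k • contToL2 (restrictUnit (besselSol ν (E k)) (hv k)) := hb
  set X : ℕ → UnitL2 := fun j => n j • contToL2 (restrictUnit _ (hxv j)) with hX
  set D : ℕ → UnitL2 := fun j => n j • contToL2 (restrictUnit _ (hd j)) with hD
  set m : ℕ → ℕ → ℝ := fun j k => inner ℝ (b k) (X j) with hm
  have hm_eq : ∀ j k, m j k =
      n k * (n j * ∫ x in (0 : ℝ)..1, besselSol ν (E k) x * (x * besselSol ν (E j) x)) :=
    fun j k => by
      simp only [hm, hX]
      rw [hbn, real_inner_smul_left, real_inner_smul_right, inner_restrictUnit]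
  -- `X j` is x times the j-th normalized eigenfunction and `D j` its derivative; the commutator
  -- identity expresses momentum matrix elements through those of position.
  have hmd : ∀ j k, inner ℝ (b k) (D j) = (E j - E k) / 2 * m j k := fun j k => by
    simp only [hD]
    rw [hm_eq, hbn, real_inner_smul_left, real_inner_smul_right, inner_restrictUnit]
    have := two_mul_integral_besselSol_mul_deriv hν (besselSeries_besselE hν k)
      (besselSeries_besselE hν j)
    linear_combination n k * n j / 2 * this
  refine ⟨fun j k => m j k ^ 2, fun j k => sq_nonneg _, fun j k => ?_, fun j => ?_, fun j => ?_⟩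
  · simp only
    rw [hm_eq, hm_eq]
    have : ∀ x, besselSol ν (E k) x * (x * besselSol ν (E j) x) =
      besselSol ν (E j) x * (x * besselSol ν (E k) x) := fun x => by ring
    simp_rw [this]
    ring
  -- Parseval for `X j` against `D j`, whose inner product is -1/2 by integration by parts.
  · have h := b.hasSum_inner_mul_inner (X j) (D j)
    have hXD : inner ℝ (X j) (D j) = -(1 / 2) := by
      rw [hX, hD]
      simp only
      rw [real_inner_smul_left, real_inner_smul_right, inner_restrictUnit, ← mul_assoc, hnn]
      have h1 := two_mul_integral_mul_besselSol_mul_deriv hν (besselSeries_besselE hν j)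
      change _ = -besselNormSq ν j at h1
      have h2 := (besselNormSq_pos hν j).ne'
      rw [show ∫ x in (0 : ℝ)..1, x * besselSol ν (E j) x * besselSolDeriv ν (E j) x =
        -besselNormSq ν j / 2 by linarith]
      field_simp
    rw [hXD] at h
    have h2 := h.mul_left (-2)
    norm_num at h2
    refine h2.congr_fun fun k => ?_
    rw [hmd, real_inner_comm]
    change _ = -(2 * (m j k * _))
    ring
  -- Parseval for the squared norm of `D j`, which is the kinetic energy.
  · have h := b.hasSum_inner_mul_inner (D j) (D j)
    have hDD : inner ℝ (D j) (D j) = besselKinetic ν j := by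
      rw [hD, besselKinetic_eq hν]
      simp only
      rw [real_inner_smul_left, real_inner_smul_right, inner_restrictUnit, ← mul_assoc, hnn,
        div_eq_inv_mul]
    rw [hDD] at h
    refine (h.mul_left 4).congr_fun fun k => ?_
    rw [real_inner_comm, hmd]
    ring

/-! ### The heat trace inequality. -/

theorem sinh_lt_mul_cosh {y : ℝ} (hy : 0 < y) : Real.sinh y < y * Real.cosh y := by
  have hd : ∀ x : ℝ, HasDerivAt (fun x => x * Real.cosh x - Real.sinh x) (x * Real.sinh x) x :=
    fun x => (((hasDerivAt_id x).mul (Real.hasDerivAt_cosh x)).sub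
      (Real.hasDerivAt_sinh x)).congr_deriv (by simp)
  have hmono : StrictMonoOn (fun x => x * Real.cosh x - Real.sinh x) (Ici 0) := by
    refine strictMonoOn_of_deriv_pos (convex_Ici 0)
      (fun x _ => (hd x).continuousAt.continuousWithinAt) fun x hx => ?_
    rw [interior_Ici] at hx
    rw [(hd x).deriv]
    exact mul_pos hx (Real.sinh_pos_iff.2 hx)
  have := hmono (mem_Ici.2 le_rfl) (mem_Ici.2 hy.le) hy
  simp at this
  exact this

/-- Dividing out exp(-(p+q)/2) leaves sinh y < y cosh y with y = (q - p)/2, and the claim is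
symmetric in p and q. -/
theorem exp_neg_sub_mul_lt {p q : ℝ} (hpq : p ≠ q) :
    (Real.exp (-p) - Real.exp (-q)) * (q - p) <
      (q - p) ^ 2 / 2 * (Real.exp (-p) + Real.exp (-q)) := by
  wlog h : p < q generalizing p q
  · have := this hpq.symm (lt_of_le_of_ne (not_lt.1 h) hpq.symm)
    linarith
  have hy : 0 < (q - p) / 2 := by linarith
  have h1 : Real.exp (-p) = Real.exp (-(p + q) / 2) * Real.exp ((q - p) / 2) := by
    rw [← Real.exp_add]; congr 1; ring
  have h2 : Real.exp (-q) = Real.exp (-(p + q) / 2) * Real.exp (-((q - p) / 2)) := by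
    rw [← Real.exp_add]; congr 1; ring
  have h3 := sinh_lt_mul_cosh hy
  rw [Real.sinh_eq, Real.cosh_eq] at h3
  have h4 : 0 < Real.exp (-(p + q) / 2) * (q - p) := by
    have : 0 < q - p := by linarith
    positivity
  have h5 := mul_lt_mul_of_pos_left h3 h4
  rw [h1, h2]
  linarith

/-- The heat trace inequality which follows from the two sum rules. -/
theorem tsum_exp_lt_of_sum_rules {E T : ℕ → ℝ} {a : ℕ → ℕ → ℝ} (ha : ∀ j k, 0 ≤ a j k)
    (hsymm : ∀ j k, a j k = a k j) (h1 : ∀ j, HasSum (fun k => (E k - E j) * a j k) 1)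
    (h2 : ∀ j, HasSum (fun k => (E k - E j) ^ 2 * a j k) (4 * T j))
    (hgap : ∀ j k, j ≠ k → 1 ≤ |E k - E j|) {t : ℝ} (ht : 0 < t)
    (hT : Summable fun j => Real.exp (-t * E j) * T j) :
    ∑' j, Real.exp (-t * E j) < 2 * t * ∑' j, Real.exp (-t * E j) * T j := by
  set e : ℕ → ℝ := fun j => Real.exp (-t * E j) with he
  have he0 : ∀ j, 0 < e j := fun j => Real.exp_pos _
  set f : ℕ × ℕ → ℝ := fun p => e p.1 * ((E p.2 - E p.1) * a p.1 p.2) with hf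
  set h : ℕ × ℕ → ℝ := fun p => e p.1 * ((E p.2 - E p.1) ^ 2 * a p.1 p.2) with hh
  have hh0 : 0 ≤ h := fun p => mul_nonneg (he0 _).le (mul_nonneg (sq_nonneg _) (ha _ _))
  have hrow : ∀ j, HasSum (fun k => h (j, k)) (e j * (4 * T j)) := fun j => (h2 j).mul_left _
  have hsh : Summable h := by
    rw [summable_prod_of_nonneg hh0]
    refine ⟨fun j => (hrow j).summable, ?_⟩
    simp_rw [(hrow _).tsum_eq]
    exact (hT.mul_left 4).congr fun j => by ring
  -- Gaps of at least 1 give |E_k - E_j| ≤ (E_k - E_j)², so the second sum rule dominates the first.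
  have hsf : Summable f := by
    refine Summable.of_norm_bounded hsh fun p => ?_
    rw [hf, hh, Real.norm_eq_abs, abs_mul, abs_mul, abs_of_pos (he0 _), abs_of_nonneg (ha _ _)]
    refine mul_le_mul_of_nonneg_left (mul_le_mul_of_nonneg_right ?_ (ha _ _)) (he0 _).le
    rcases eq_or_ne p.1 p.2 with hp | hp
    · simp [hp]
    · rw [← sq_abs]
      have := hgap _ _ hp
      nlinarith
  have hsf' : Summable fun p => f (Prod.swap p) := (Equiv.prodComm ℕ ℕ).summable_iff.2 hsf
  have hsh' : Summable fun p => h (Prod.swap p) := (Equiv.prodComm ℕ ℕ).summable_iff.2 hsh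
  have htf : ∑' p, f p = ∑' j, e j := by
    rw [hsf.tsum_prod]
    refine tsum_congr fun j => ?_
    have := ((h1 j).mul_left (e j)).tsum_eq
    simpa using this
  have hth : ∑' p, h p = 4 * ∑' j, e j * T j := by
    rw [hsh.tsum_prod, ← tsum_mul_left]
    refine tsum_congr fun j => ?_
    rw [(hrow j).tsum_eq]
    ring
  have hpt : ∀ j k, j ≠ k → (e j - e k) * (E k - E j) < t / 2 * (E k - E j) ^ 2 * (e j + e k) := by
    intro j k hjk
    have hne : t * E j ≠ t * E k := fun h => by
      have := hgap j k hjk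
      rw [mul_left_cancel₀ ht.ne' h, sub_self, abs_zero] at this
      linarith
    have := exp_neg_sub_mul_lt hne
    rw [← neg_mul, ← neg_mul] at this
    change (e j - e k) * _ < _ * (e j + e k) at this
    by_contra! hcon
    have := mul_le_mul_of_nonneg_left hcon ht.le
    nlinarith
  have hadd : ∀ p, f p + f (p.swap) = (e p.1 - e p.2) * (E p.2 - E p.1) * a p.1 p.2 := fun p => by
    simp only [hf, Prod.fst_swap, Prod.snd_swap]
    rw [hsymm p.2 p.1]
    ring
  have hadd' : ∀ p, t / 2 * (h p + h p.swap) =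
      t / 2 * (E p.2 - E p.1) ^ 2 * (e p.1 + e p.2) * a p.1 p.2 := fun p => by
    simp only [hh, Prod.fst_swap, Prod.snd_swap]
    rw [hsymm p.2 p.1]
    ring
  -- Row 0 sums to 1, so it has a nonzero entry; this is where the inequality is strict.
  obtain ⟨k, hk⟩ : ∃ k, (E k - E 0) * a 0 k ≠ 0 := by
    by_contra! hall
    have := (h1 0).tsum_eq
    simp [hall] at this
  -- Adding each double sum to its transpose makes the comparison termwise.
  have hlt : ∑' p, (f p + f p.swap) < ∑' p, t / 2 * (h p + h p.swap) := by
    refine Summable.tsum_lt_tsum (i := (0, k)) (fun p => ?_) ?_ (hsf.add hsf')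
      ((hsh.add hsh').mul_left _)
    · rw [hadd, hadd']
      refine mul_le_mul_of_nonneg_right ?_ (ha _ _)
      rcases eq_or_ne p.1 p.2 with hp | hp
      · simp [hp]
      · exact (hpt _ _ hp).le
    · rw [hadd, hadd']
      have hk0 : 0 ≠ k := by
        rintro rfl
        simp at hk
      exact mul_lt_mul_of_pos_right (hpt 0 k hk0)
        (lt_of_le_of_ne (ha _ _) (Ne.symm (right_ne_zero_of_mul hk)))
  have e1 : ∑' p, f (Prod.swap p) = ∑' p, f p := (Equiv.prodComm ℕ ℕ).tsum_eq f
  have e2 : ∑' p, h (Prod.swap p) = ∑' p, h p := (Equiv.prodComm ℕ ℕ).tsum_eq h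
  rw [hsf.tsum_add hsf', tsum_mul_left, hsh.tsum_add hsh', e1, e2, htf, hth] at hlt
  linarith

/-! ### Convergence and differentiation of the partition function. -/

theorem summable_pi_sq_mul_rpow {p : ℝ} (hp : 1 / 2 < p) :
    Summable fun k : ℕ => (Real.pi ^ 2 * ((k : ℝ) + 1) ^ 2) ^ (-p) := by
  have h1 : Summable fun k : ℕ => ((k + 1 : ℕ) : ℝ) ^ (-(2 * p)) :=
    (summable_nat_add_iff (f := fun n : ℕ => (n : ℝ) ^ (-(2 * p))) 1).2
      (Real.summable_nat_rpow.2 (by linarith))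
  refine (h1.mul_left ((Real.pi ^ 2) ^ (-p))).congr fun k => ?_
  rw [Real.mul_rpow (by positivity) (by positivity)]
  congr 1
  push_cast
  rw [← Real.rpow_natCast, ← Real.rpow_mul (by positivity)]
  norm_num

theorem besselE_rpow_neg_le {ν : ℝ} (hν : 1 / 2 < ν) {p : ℝ} (hp : 0 ≤ p) (k : ℕ) :
    besselE ν k ^ (-p) ≤ (Real.pi ^ 2 * ((k : ℝ) + 1) ^ 2) ^ (-p) :=
  Real.rpow_le_rpow_of_nonpos (by positivity) (sq_mul_le_besselE hν k) (by linarith)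

theorem summable_besselE_rpow {ν : ℝ} (hν : 1 / 2 < ν) {p : ℝ} (hp : 1 / 2 < p) :
    Summable fun k => besselE ν k ^ (-p) :=
  Summable.of_nonneg_of_le (fun k => Real.rpow_nonneg (besselE_pos hν k).le _)
    (besselE_rpow_neg_le hν (by linarith)) (summable_pi_sq_mul_rpow hp)

/-- From exp x ≥ x²/2 at x = sE, followed by the ν-free lower bound on E. The explicit power of s is
needed for locally uniform domination. -/
theorem exp_mul_besselE_le {ν : ℝ} (hν : 1 / 2 < ν) {s : ℝ} (hs : 0 < s) (k : ℕ) :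
    Real.exp (-s * besselE ν k) * besselE ν k ≤
      2 / s ^ 2 * (Real.pi ^ 2 * ((k : ℝ) + 1) ^ 2) ^ (-1 : ℝ) := by
  have hE := besselE_pos hν k
  refine le_trans ?_ (mul_le_mul_of_nonneg_left
    (besselE_rpow_neg_le hν zero_le_one k) (by positivity))
  rw [Real.rpow_neg_one, neg_mul, Real.exp_neg, ← div_eq_mul_inv, inv_mul_eq_div,
    div_div, div_le_div_iff₀ (Real.exp_pos _) (by positivity)]
  have h := Real.quadratic_le_exp_of_nonneg (x := s * besselE ν k) (by positivity)
  have : 0 ≤ s * besselE ν k := by positivity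
  nlinarith

theorem summable_exp_mul_besselE {ν : ℝ} (hν : 1 / 2 < ν) {s : ℝ} (hs : 0 < s) :
    Summable fun k => Real.exp (-s * besselE ν k) * besselE ν k :=
  Summable.of_nonneg_of_le (fun k => mul_nonneg (Real.exp_pos _).le (besselE_pos hν k).le)
    (exp_mul_besselE_le hν hs) ((summable_pi_sq_mul_rpow (by norm_num)).mul_left _)

theorem one_le_besselE {ν : ℝ} (hν : 1 / 2 < ν) (k : ℕ) : 1 ≤ besselE ν k := by
  refine le_trans ?_ (sq_mul_le_besselE hν k)
  have h1 : 1 ≤ Real.pi ^ 2 := by nlinarith [Real.pi_gt_three]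
  have h2 : (1 : ℝ) ≤ ((k : ℝ) + 1) ^ 2 := by nlinarith [(k.cast_nonneg : (0 : ℝ) ≤ k)]
  nlinarith

theorem summable_exp_besselE {ν : ℝ} (hν : 1 / 2 < ν) {s : ℝ} (hs : 0 < s) :
    Summable fun k => Real.exp (-s * besselE ν k) :=
  Summable.of_nonneg_of_le (fun _ => (Real.exp_pos _).le)
    (fun k => le_mul_of_one_le_right (Real.exp_pos _).le (one_le_besselE hν k))
    (summable_exp_mul_besselE hν hs)

theorem summable_exp_mul_besselKinetic {ν : ℝ} (hν : 1 / 2 < ν) {s : ℝ} (hs : 0 < s) :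
    Summable fun k => Real.exp (-s * besselE ν k) * besselKinetic ν k :=
  Summable.of_nonneg_of_le (fun k => mul_nonneg (Real.exp_pos _).le (besselKinetic_nonneg hν k))
    (fun k => mul_le_mul_of_nonneg_left (besselKinetic_le hν k) (Real.exp_pos _).le)
    (summable_exp_mul_besselE hν hs)

theorem tsum_exp_besselE_lt {ν : ℝ} (hν : 1 / 2 < ν) {s : ℝ} (hs : 0 < s) :
    ∑' k, Real.exp (-s * besselE ν k) <
      2 * s * ∑' k, Real.exp (-s * besselE ν k) * besselKinetic ν k := by
  obtain ⟨a, ha, hsymm, h1, h2⟩ := exists_position_matrix hν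
  refine tsum_exp_lt_of_sum_rules ha hsymm h1 h2 (fun j k hjk => ?_) hs
    (summable_exp_mul_besselKinetic hν hs)
  have hπ : 1 ≤ Real.pi ^ 2 := by nlinarith [Real.pi_gt_three]
  rcases lt_or_gt_of_ne hjk with h | h
  · exact (hπ.trans (pi_sq_le_sub hν (besselE_mem hν j) (besselE_mem hν k)
      (strictMono_besselE hν h))).trans (le_abs_self _)
  · rw [abs_sub_comm]
    exact (hπ.trans (pi_sq_le_sub hν (besselE_mem hν k) (besselE_mem hν j)
      (strictMono_besselE hν h))).trans (le_abs_self _)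

theorem hasDerivAt_sq_sub_quarter (ν : ℝ) :
    HasDerivAt (fun ν : ℝ => ν ^ 2 - 1 / 4) (2 * ν) ν := by
  simpa using (hasDerivAt_pow 2 ν).sub_const (1 / 4)

/-- By Feynman–Hellmann, E_k/c has ν-derivative -2ν T_k/c² with c = ν² - 1/4. -/
theorem hasDerivAt_exp_besselE {ν : ℝ} (hν : 1 / 2 < ν) (t : ℝ) (k : ℕ) :
    HasDerivAt (fun ν => Real.exp (-t * (ν ^ 2 - 1 / 4)⁻¹ * besselE ν k))
      (2 * ν * t / (ν ^ 2 - 1 / 4) ^ 2 *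
        (Real.exp (-(t * (ν ^ 2 - 1 / 4)⁻¹) * besselE ν k) * besselKinetic ν k)) ν := by
  have hc := (sq_sub_quarter_pos hν).ne'
  have h := ((((hasDerivAt_sq_sub_quarter ν).inv hc).const_mul (-t)).mul
    (hasDerivAt_besselE hν k)).exp
  refine h.congr_deriv ?_
  simp only [Pi.mul_apply, Pi.inv_apply]
  rw [neg_mul t, besselKinetic]
  field_simp
  ring

theorem hasDerivAt_tsum_exp_besselE {ν : ℝ} (hν : 1 / 2 < ν) {t : ℝ} (ht : 0 < t) :
    HasDerivAt (fun ν => ∑' k, Real.exp (-t * (ν ^ 2 - 1 / 4)⁻¹ * besselE ν k))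
      (2 * ν * t / (ν ^ 2 - 1 / 4) ^ 2 *
        ∑' k, Real.exp (-(t * (ν ^ 2 - 1 / 4)⁻¹) * besselE ν k) * besselKinetic ν k) ν := by
  have hmem : ν ∈ Ioo (1 / 2) (ν + 1) := ⟨hν, by linarith⟩
  have hs : 0 < t * (ν ^ 2 - 1 / 4)⁻¹ := mul_pos ht (inv_pos.2 (sq_sub_quarter_pos hν))
  rw [← tsum_mul_left]
  -- The factor s⁻² = c²/t² from the exponential bound cancels the c² in the denominator, so one
  -- majorant serves all of (1/2, ν + 1).
  refine hasDerivAt_tsum_of_isPreconnected (u := fun k : ℕ => 4 * (ν + 1) / t *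
    (Real.pi ^ 2 * ((k : ℝ) + 1) ^ 2) ^ (-1 : ℝ))
    ((summable_pi_sq_mul_rpow (by norm_num)).mul_left _) isOpen_Ioo isPreconnected_Ioo
    (fun k μ hμ => hasDerivAt_exp_besselE hμ.1 t k) (fun k μ hμ => ?_) hmem ?_ hmem
  · have hc := sq_sub_quarter_pos hμ.1
    have hμ0 : 0 < μ := by linarith [hμ.1]
    have hsμ : 0 < t * (μ ^ 2 - 1 / 4)⁻¹ := by positivity
    have hT := besselKinetic_nonneg hμ.1 k
    rw [Real.norm_of_nonneg (by positivity)]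
    calc _ ≤ 2 * μ * t / (μ ^ 2 - 1 / 4) ^ 2 *
          (Real.exp (-(t * (μ ^ 2 - 1 / 4)⁻¹) * besselE μ k) * besselE μ k) := by
          gcongr; exact besselKinetic_le hμ.1 k
      _ ≤ 2 * μ * t / (μ ^ 2 - 1 / 4) ^ 2 * (2 / (t * (μ ^ 2 - 1 / 4)⁻¹) ^ 2 *
          (Real.pi ^ 2 * ((k : ℝ) + 1) ^ 2) ^ (-1 : ℝ)) := by
          exact mul_le_mul_of_nonneg_left (exp_mul_besselE_le hμ.1 hsμ k) (by positivity)
      _ = 4 * μ / t * (Real.pi ^ 2 * ((k : ℝ) + 1) ^ 2) ^ (-1 : ℝ) := by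
          rw [← mul_assoc]
          congr 1
          have hc' := hc.ne'
          generalize μ ^ 2 - 1 / 4 = c at hc'
          field_simp
          norm_num
      _ ≤ _ := by
          gcongr
          exact hμ.2.le
  · refine (summable_exp_besselE hν hs).congr fun k => ?_
    rw [neg_mul t]

theorem strictMonoOn_besselPartition {t : ℝ} (ht : 0 < t) :
    StrictMonoOn (fun ν => besselPartition t ν) (Ioi (1 / 2)) := by
  have hd : ∀ ν : ℝ, 1 / 2 < ν → ∃ d > 0, HasDerivAt (fun ν => besselPartition t ν) d ν := by
    intro ν hν
    have hc := sq_sub_quarter_pos hν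
    have hs : 0 < t * (ν ^ 2 - 1 / 4)⁻¹ := mul_pos ht (inv_pos.2 hc)
    have h1 := (hasDerivAt_sq_sub_quarter ν).rpow_const (p := (-(1 / 2) : ℝ)) (Or.inl hc.ne')
    refine ⟨_, ?_, h1.mul (hasDerivAt_tsum_exp_besselE hν ht)⟩
    have hlt := tsum_exp_besselE_lt hν hs
    simp only [neg_mul t]
    set c := ν ^ 2 - 1 / 4 with hcdef
    set A := ∑' k, Real.exp (-(t * c⁻¹) * besselE ν k)
    set B := ∑' k, Real.exp (-(t * c⁻¹) * besselE ν k) * besselKinetic ν k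
    have hpow : c ^ (-(1 / 2) - 1 : ℝ) = c ^ (-(1 / 2) : ℝ) / c := Real.rpow_sub_one hc.ne' _
    rw [hpow]
    have hX : 0 < c ^ (-(1 / 2) : ℝ) := Real.rpow_pos_of_pos hc _
    set X := c ^ (-(1 / 2) : ℝ)
    -- The derivative is ν c^(-3/2) (2sB - A) with s = t/c, positive by the trace inequality.
    have : 2 * ν * (-(1 / 2)) * (X / c) * A + X * (2 * ν * t / c ^ 2 * B) =
        ν * X / c * (2 * (t * c⁻¹) * B - A) := by
      field_simp
      ring
    rw [this]
    have h3 : 0 < 2 * (t * c⁻¹) * B - A := by linarith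
    positivity
  refine strictMonoOn_of_deriv_pos (convex_Ioi _) (fun ν hν => ?_) fun ν hν => ?_
  · obtain ⟨d, -, h⟩ := hd ν hν
    exact h.continuousAt.continuousWithinAt
  · rw [interior_Ioi] at hν
    obtain ⟨d, hpos, h⟩ := hd ν hν
    rwa [h.deriv]

/-! ### Moments as Mellin transforms, and the conclusion. -/

theorem differentiableAt_besselMoment {ν : ℝ} (hν : 1 / 2 < ν) {p : ℝ} (hp : 1 / 2 < p) :
    DifferentiableAt ℝ (fun μ => besselMoment p μ) ν := by
  -- Staying above some a > 1/2 keeps ν² - 1/4 away from zero in the majorant.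
  obtain ⟨a, ha, haν⟩ := exists_between hν
  have hmem : ν ∈ Ioo a (ν + 1) := ⟨haν, by linarith⟩
  have hca := sq_sub_quarter_pos ha
  have hsum : DifferentiableAt ℝ (fun μ => ∑' k, besselE μ k ^ (-p)) ν := by
    refine (hasDerivAt_tsum_of_isPreconnected (t := Ioo a (ν + 1)) (u := fun k : ℕ =>
      2 * (ν + 1) * p / (a ^ 2 - 1 / 4) * (Real.pi ^ 2 * ((k : ℝ) + 1) ^ 2) ^ (-p))
      ((summable_pi_sq_mul_rpow hp).mul_left _) isOpen_Ioo isPreconnected_Ioo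
      (fun k μ hμ => (hasDerivAt_besselE (ha.trans hμ.1) k).rpow_const
        (Or.inl (besselE_pos (ha.trans hμ.1) k).ne')) (fun k μ hμ => ?_) hmem
      (summable_besselE_rpow hν hp) hmem).differentiableAt
    have hμ' := ha.trans hμ.1
    have hE := besselE_pos hμ' k
    have hP := besselInvSq_nonneg hμ' k
    have hc := sq_sub_quarter_pos hμ'
    -- Nonnegative kinetic energy bounds the derivative of E_k by a multiple of E_k itself.
    have hPE : besselInvSq μ k ≤ besselE μ k / (μ ^ 2 - 1 / 4) := by
      rw [le_div_iff₀ hc]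
      have := besselKinetic_nonneg hμ' k
      rw [besselKinetic] at this
      linarith
    have hμ0 : 0 < μ := by linarith
    have hX : 0 < besselE μ k ^ (-p) := Real.rpow_pos_of_pos hE _
    have hp0 : 0 < p := by linarith
    rw [Real.rpow_sub_one hE.ne', mul_neg, neg_mul, norm_neg, Real.norm_of_nonneg (by positivity)]
    calc 2 * μ * besselInvSq μ k * p * (besselE μ k ^ (-p) / besselE μ k)
        ≤ 2 * μ * (besselE μ k / (μ ^ 2 - 1 / 4)) * p *
          (besselE μ k ^ (-p) / besselE μ k) := by gcongr
      _ = 2 * μ * p / (μ ^ 2 - 1 / 4) * besselE μ k ^ (-p) := by field_simp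
      _ ≤ _ := by
          have ha0 : 0 < a := by linarith
          have h1 := besselE_rpow_neg_le hμ' hp0.le k
          have h2 := hμ.1.le
          have h3 := hμ.2.le
          gcongr
  have hpow : DifferentiableAt ℝ (fun μ : ℝ => (μ ^ 2 - 1 / 4) ^ (p - 1 / 2)) ν :=
    ((hasDerivAt_sq_sub_quarter ν).rpow_const
      (Or.inl (sq_sub_quarter_pos hν).ne')).differentiableAt
  exact hpow.mul hsum

theorem besselMoment_pos {ν : ℝ} (hν : 1 / 2 < ν) {p : ℝ} (hp : 1 / 2 < p) :
    0 < besselMoment p ν :=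
  mul_pos (Real.rpow_pos_of_pos (sq_sub_quarter_pos hν) _)
    ((summable_besselE_rpow hν hp).tsum_pos
      (fun k => Real.rpow_nonneg (besselE_pos hν k).le _) 0
      (Real.rpow_pos_of_pos (besselE_pos hν 0) _))

/-- The moments are Mellin transforms of the partition function. -/
theorem integral_rpow_mul_besselPartition {ν : ℝ} (hν : 1 / 2 < ν) {p : ℝ} (hp : 1 / 2 < p) :
    ∫ s in Ioi (0 : ℝ), s ^ (p - 1) * besselPartition s ν = Real.Gamma p * besselMoment p ν := by
  have hc := sq_sub_quarter_pos hν
  have hp0 : 0 < p := by linarith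
  have hΓ := Real.Gamma_pos_of_pos hp0
  set c := ν ^ 2 - 1 / 4 with hcdef
  set F : ℕ → ℝ → ℝ := fun k s => s ^ (p - 1) * Real.exp (-s * c⁻¹ * besselE ν k) with hF
  have hint : ∀ k, ∫ s in Ioi (0 : ℝ), F k s = c ^ p * Real.Gamma p * besselE ν k ^ (-p) := by
    intro k
    have hE := besselE_pos hν k
    have h := Real.integral_rpow_mul_exp_neg_mul_Ioi hp0
      (show 0 < c⁻¹ * besselE ν k by positivity)
    calc ∫ s in Ioi (0 : ℝ), F k s
        = ∫ s in Ioi (0 : ℝ), s ^ (p - 1) * Real.exp (-(c⁻¹ * besselE ν k * s)) := by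
          refine integral_congr_ae (Eventually.of_forall fun s => ?_)
          simp only [hF]
          congr 2
          ring
      _ = _ := by
          rw [h, one_div, mul_inv, inv_inv, Real.mul_rpow hc.le (by positivity),
            Real.inv_rpow hE.le, ← Real.rpow_neg hE.le]
          ring
  have hFi : ∀ k, Integrable (F k) (volume.restrict (Ioi 0)) := fun k => by
    -- A non-integrable function has integral 0 by convention, so a nonzero value certifies
    -- integrability.
    refine Integrable.of_integral_ne_zero ?_
    rw [hint]
    have := Real.rpow_pos_of_pos (besselE_pos hν k) (-p)
    positivity
  have hnorm : ∀ k, ∫ s in Ioi (0 : ℝ), ‖F k s‖ = c ^ p * Real.Gamma p * besselE ν k ^ (-p) := by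
    intro k
    rw [← hint]
    refine setIntegral_congr_fun measurableSet_Ioi fun s hs => ?_
    have : 0 < s := hs
    exact Real.norm_of_nonneg (by positivity)
  have hsum := hasSum_integral_of_summable_integral_norm hFi
    (((summable_besselE_rpow hν hp).mul_left (c ^ p * Real.Gamma p)).congr fun k => (hnorm k).symm)
  have h1 := hsum.tsum_eq
  simp_rw [hint] at h1
  rw [tsum_mul_left] at h1
  have h2 : ∫ s in Ioi (0 : ℝ), s ^ (p - 1) * besselPartition s ν =
      c ^ (-(1 / 2) : ℝ) * ∫ s in Ioi (0 : ℝ), ∑' k, F k s := by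
    rw [← integral_const_mul]
    refine integral_congr_ae (Eventually.of_forall fun s => ?_)
    simp only [hF, besselPartition]
    rw [tsum_mul_left]
    ring
  rw [h2, ← h1, besselMoment, ← hcdef, show p - 1 / 2 = -(1 / 2) + p by ring, Real.rpow_add hc]
  ring

theorem monotoneOn_besselMoment {p : ℝ} (hp : 1 / 2 < p) :
    MonotoneOn (fun ν => besselMoment p ν) (Ioi (1 / 2)) := by
  intro ν₁ h1 ν₂ h2 h12
  have hΓ := Real.Gamma_pos_of_pos (show 0 < p by linarith)
  have hi : ∀ ν : ℝ, 1 / 2 < ν →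
      IntegrableOn (fun s => s ^ (p - 1) * besselPartition s ν) (Ioi 0) := fun ν hν => by
    refine Integrable.of_integral_ne_zero ?_
    rw [integral_rpow_mul_besselPartition hν hp]
    exact (mul_pos hΓ (besselMoment_pos hν hp)).ne'
  have h := setIntegral_mono_on (hi ν₁ h1) (hi ν₂ h2) measurableSet_Ioi fun s hs =>
    mul_le_mul_of_nonneg_left ((strictMonoOn_besselPartition hs).monotoneOn h1 h2 h12)
      (Real.rpow_nonneg (le_of_lt hs) _)
  rw [integral_rpow_mul_besselPartition h1 hp, integral_rpow_mul_besselPartition h2 hp] at h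
  exact le_of_mul_le_mul_left h hΓ

theorem mainTheorem12 :
    (∀ ν : ℝ, 1 / 2 < ν →
      StrictMono (besselE ν) ∧ Set.range (besselE ν) = besselDirichletEigenvalues ν) ∧
    (∀ t : ℝ, 0 < t →
      (∀ ν : ℝ, 1 / 2 < ν →
        Summable fun k : ℕ => Real.exp (-t * (ν ^ 2 - 1 / 4)⁻¹ * besselE ν k)) ∧
      StrictMonoOn (fun ν : ℝ => besselPartition t ν) (Set.Ioi (1 / 2))) ∧
    (∀ p : ℝ, 1 / 2 < p → ∀ ν : ℝ, 1 / 2 < ν →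
      (Summable fun k : ℕ => besselE ν k ^ (-p)) ∧
      DifferentiableAt ℝ (fun μ : ℝ => besselMoment p μ) ν ∧
      0 ≤ deriv (fun μ : ℝ => besselMoment p μ) ν) := by
  refine ⟨fun ν hν => ⟨strictMono_besselE hν, range_besselE hν⟩, fun t ht => ⟨fun ν hν => ?_,
    strictMonoOn_besselPartition ht⟩, fun p hp ν hν => ⟨summable_besselE_rpow hν hp,
    differentiableAt_besselMoment hν hp, ?_⟩⟩
  · have hs : 0 < t * (ν ^ 2 - 1 / 4)⁻¹ := mul_pos ht (inv_pos.2 (sq_sub_quarter_pos hν))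
    exact (summable_exp_besselE hν hs).congr fun k => by rw [neg_mul t]
  · rw [← derivWithin_of_isOpen isOpen_Ioi (mem_Ioi.2 hν)]
    exact (monotoneOn_besselMoment hp).derivWithin_nonneg
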